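/- Let $K$ be a field. A \emph{point} of $K$ is a two-dimensional regular local subring $S\subset K$ with field of fractions $K$; write $\mathfrak m_S$ for its maximal ideal, $k_S$ for its residue field, $\mathrm{ord}_S$ for the order with respect to $\mathfrak m_S$ (for a nonzero ideal, the minimum of the orders of its nonzero elements), and $V_S\subset K$ for the valuation ring of the discrete valuation $\mathrm{ord}_S$. If $R\subseteq S$ are points, then $S$ is called \emph{infinitely near} to $R$; let $\Omega(R)$ be the set of all points infinitely near to $R$. For $T\in\Omega(S)$ put $[T:S]=[k_T:k_S]$, and write $T\succ S$ ($T$ is \emph{proximate} to $S$) if $T\subseteq V_S$. For $S\in\Omega(R)$ call a prime element $q$ of $S$ \emph{exceptional} if $qS\cap R$ has height $2$; the curves $qS$, $q$ exceptional, are the components of the exceptional divisor of $S$ over $R$ (there are none if $S=R$). The \emph{strict transform} $\mathfrak a^S$ of a nonzero ideal $\mathfrak a$ of $R$ is the ideal obtained from $\mathfrak aS$ by dividing out all exceptional prime factors. A \emph{curvette} at $T\in\Omega(R)$ is an element $g\in T$ such that: the exceptional divisor of $T$ over $R$ has at most one component; $\mathfrak m_T=(x,g)$ for some $x\in T$ such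 that the exceptional divisor has no component other than $xT$; $\mathrm{ord}_T((gT\cap R)^T)=1$; and $(gT\cap R)^{S'}=S'$ for all $S'\in\Omega(R)$ with $S'\not\subseteq T$ and $T\not\subseteq S'$. Let $R$ be a point of $K$. (i) For every nonzero $f\in R$ and every $S\in\Omega(R)$ (in particular for every point $S$ of the cluster of a resolution of $f$), there are only finitely many points $T\succ S$, $T\neq S$, with $(fR)^T\neq T$, and $$\mathrm{ord}_S\big((fR)^S\big)=\sum_{T\succ S,\ T\ne S}[T:S]\,\mathrm{ord}_T\big((fR)^T\big),$$ the sum being over all points $T\neq S$ that are proximate to $S$. (ii) For every $T\in\Omega(R)$, every curvette $g$ at $T$ and every $S\in\Omega(R)$, there are only finitely many points $T'\succ S$, $T'\neq S$, with $(gT\cap R)^{T'}\neq T'$, and $$\mathrm{ord}_S\big((gT\cap R)^S\big)=\sum_{T'\succ S,\ T'\ne S}[T':S]\,\mathrm{ord}_{T'}\big((gT\cap R)^{T'}\big).$$ -/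

import Mathlib

open IsLocalRing

noncomputable section

/-- A point of a field `K`: a two-dimensional regular local subring of `K` having `K` as its field
of fractions. -/
@[ext]
structure Point (K : Type*) [Field K] where
  /-- the underlying ring -/
  ring : Subring K
  regular : IsRegularLocalRing ring
  dim_eq_two : ringKrullDim ring = 2
  isFractionRing : IsFractionRing ring K

namespace Point

variable {K : Type*} [Field K]

instance (S : Point K) : IsRegularLocalRing S.ring := S.regular

/-- `R ≤ S` means `R ⊆ S`, i.e. the point `S` is infinitely near to the point `R`. -/
instance : LE (Point K) := ⟨fun R S => R.ring ≤ S.ring⟩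

theorem le_trans' {R S T : Point K} (h₁ : R ≤ S) (h₂ : S ≤ T) : R ≤ T :=
  fun _ hx => h₂ (h₁ hx)

/-- The inclusion homomorphism `R → S` for `R ⊆ S`. -/
def incl {R S : Point K} (h : R ≤ S) : R.ring →+* S.ring := Subring.inclusion h

end Point

/-- The order of a nonzero element `f` of a Noetherian local ring `A`: the number `m` with
`f ∈ 𝔪 ^ m` and `f ∉ 𝔪 ^ (m + 1)`. -/
def elemOrd {A : Type*} [CommRing A] [IsLocalRing A] (f : A) : ℕ :=
  sSup {n : ℕ | f ∈ maximalIdeal A ^ n}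

/-- The order of a nonzero ideal: the minimum of the orders of its nonzero elements. -/
def idealOrd {A : Type*} [CommRing A] [IsLocalRing A] (a : Ideal A) : ℕ :=
  sInf {n : ℕ | ∃ f ∈ a, f ≠ 0 ∧ elemOrd f = n}

/-- Let `φ : A → B` be the inclusion of factorial domains with the same quotient field. A prime
element `q` of `B` is exceptional over `A` if `qB ∩ A` has height at least two. -/
def IsExceptionalPrime {A B : Type*} [CommRing A] [CommRing B] (φ : A →+* B) (q : B) : Prop :=
  Prime q ∧ 1 < ((Ideal.span {q}).comap φ).height

/-- The strict transform `𝔞 ^ B` of a nonzero ideal `𝔞` of `A` along an inclusion `φ : A → B` of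
factorial domains with the same quotient field: what remains of `𝔞 B` after all exceptional prime
factors have been divided out, i.e. the largest ideal `J` with `𝔞 B = c J` where all prime factors
of `c` are exceptional. -/
def strictTransform {A B : Type*} [CommRing A] [CommRing B] (φ : A →+* B) (a : Ideal A) :
    Ideal B :=
  sSup {J : Ideal B | ∃ c : B, c ≠ 0 ∧ (∀ q : B, Prime q → q ∣ c → IsExceptionalPrime φ q) ∧
    a.map φ = Ideal.span {c} * J}

namespace Point

variable {K : Type*} [Field K]

/-- The strict transform in `S ⊇ R` of an ideal of `R`. -/
def strict {R S : Point K} (h : R ≤ S) (a : Ideal R.ring) : Ideal S.ring :=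
  strictTransform (incl h) a

/-- The valuation ring `V_S` of the order valuation of `S`: all quotients `a / b` with `a, b ∈ S`,
`b ≠ 0` and either `a = 0` or `ord a ≥ ord b`. -/
def orderValuationRing (S : Point K) : Set K :=
  {z : K | ∃ a b : S.ring, b ≠ 0 ∧ (a = 0 ∨ elemOrd b ≤ elemOrd a) ∧ z = (a : K) / (b : K)}

/-- `T` is proximate to `S`: `T` is infinitely near to `S` and contained in `V_S`. -/
def IsProximate (S T : Point K) : Prop :=
  S ≤ T ∧ (T.ring : Set K) ⊆ S.orderValuationRing

/-- The points proximate to `S` and different from `S`. -/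
abbrev ProximateTo (S : Point K) := {T : Point K // IsProximate S T ∧ T ≠ S}

theorem ProximateTo.le {S : Point K} (T : ProximateTo S) : S ≤ T.1 := T.2.1.1

open Classical in
/-- The degree `[T : S] = [k_T : k_S]` of the residue field extension of `S ⊆ T`, where `T`
dominates `S`. -/
def degree {S T : Point K} (h : S ≤ T) : ℕ :=
  if hl : IsLocalHom (incl h) then
    letI : Algebra (ResidueField S.ring) (ResidueField T.ring) :=
      (haveI := hl; ResidueField.map (incl h)).toAlgebra
    Module.finrank (ResidueField S.ring) (ResidueField T.ring)
  else 0

/-- `g ∈ S` is a curvette at `S ⊇ R`. The components of the exceptional divisor of `S` over `R` are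
the curves `qS` with `q` an exceptional prime. -/
structure IsCurvette {R S : Point K} (h : R ≤ S) (g : S.ring) : Prop where
  /-- `S` is not the intersection of two components of the exceptional divisor. -/
  not_satellite : ∀ q q' : S.ring, IsExceptionalPrime (incl h) q →
    IsExceptionalPrime (incl h) q' → Associated q q'
  /-- `g` crosses the exceptional divisor normally: it is part of a regular system of parameters
  `{x, g}` of `S` such that the exceptional divisor has no component other than `xS`. -/
  normal_crossing : ∃ x : S.ring, maximalIdeal S.ring = Ideal.span {x, g} ∧
    ∀ q : S.ring, IsExceptionalPrime (incl h) q → Associated q x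
  /-- The strict transform at `S` of the curve `gS ∩ R` has no singularities. -/
  smooth : idealOrd (strict h ((Ideal.span {g}).comap (incl h))) = 1
  /-- The curve `gS ∩ R` passes through no point over `R` that is incomparable with `S`. -/
  only_at : ∀ (S' : Point K) (h' : R ≤ S'), ¬ S ≤ S' → ¬ S' ≤ S →
    strict h' ((Ideal.span {g}).comap (incl h)) = ⊤

end Point

end

/-!
The proximity formula is Noether's formula for the intersection multiplicity of a curve with the
exceptional line of a blow-up, summed over the closed points of that line.

Fix parameters `x, y` of `S` and put `t = y / x`. An element `h` of `S` of order `n` can be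
written `h = x ^ n * A(t)` with a polynomial `A` of degree at most `n` over `S` that does not
vanish modulo `𝔪`; its reduction `P` is the dehomogenized leading form of `h`. Counted with
multiplicity and degree, `P` has `n` zeros on the projective line over the residue field of `S`,
if the zero at infinity, of multiplicity `n - deg P`, is included. The essential algebraic fact is
`Point.red_eq_zero_of_ev_eq_zero`, a consequence of Gauss's lemma: a polynomial over a point that
vanishes at a quotient of coprime non-units vanishes modulo the maximal ideal. It makes `P` well
defined, it describes the order valuation ring `V` as the ring of all `A(t) / B(t)` with `B`
nonzero modulo `𝔪` (`IsParamPair.mem_orderValuationRing_iff`), and it shows that the rings of the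
closed points of the blow-up are again points (`IsParamPair.blowup`).

A point `T` properly containing `S` contains `y / x` or `x / y` (`IsParamPair.div_mem_or_div_mem`).
Indeed, if both were missing, then `y / x` would be a quotient of coprime non-units of `T`, so all
elements of the maximal ideal of `T` would have order valuation less than one; then `x` and `y`
would be coprime in `T`, no curve of `T` would be contracted in `S`, and `T` would be equal to
`S`. It follows that a point `T ≠ S` proximate to `S` lies over exactly one closed point of the
exceptional line, and that the proximate points over such a closed point form a chain: each of
them is the point in the blow-up of its predecessor that lies on the strict transform of the
exceptional line (`Point.IsBranch.overIn_eq`). The residue field does not change along the chain.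
If `e` is an equation of the exceptional line in a member `T` of the chain and `z` a second
parameter, passing to the next member replaces `e` by `e / z` and the strict transform `g`
by `g / z ^ ord g`, which lowers the value of `g` in the discrete valuation ring `T / eT` by `ord g`.
Hence the multiplicities along the chain add up to the value at its beginning
(`Point.IsBranch.sum_weight`), which is the multiplicity of the corresponding zero of the leading
form. The sum over all zeros, weighted by degrees, is `n`.

Strict transforms relative to the base point `R` are reduced to those relative to `S` by
transitivity (`Point.IsStrict.trans`). The curve cut out on `R` by a curvette is principal,
because a curvette that is an exceptional curve would have an empty strict transform
(`Point.IsCurvette.exists_comap_eq_span`).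
-/

noncomputable section

open Polynomial

/-! ### Two-dimensional regular local domains -/

section LocalAlgebra

variable {A : Type*} [CommRing A] [IsLocalRing A]

theorem elemOrd_eq {f : A} {n : ℕ} (h1 : f ∈ maximalIdeal A ^ n)
    (h2 : f ∉ maximalIdeal A ^ (n + 1)) : elemOrd f = n := by
  have hub : ∀ m ∈ {n : ℕ | f ∈ maximalIdeal A ^ n}, m ≤ n := by
    intro m hm
    by_contra! hlt
    exact h2 (Ideal.pow_le_pow_right hlt hm)
  exact le_antisymm (csSup_le ⟨n, h1⟩ hub) (le_csSup ⟨n, hub⟩ h1)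

theorem elemOrd_eq_zero_of_isUnit {f : A} (hf : IsUnit f) : elemOrd f = 0 := by
  refine elemOrd_eq (by simp) ?_
  rw [zero_add, pow_one]
  exact fun h => h hf

/-- `x, y` is a regular system of parameters of the two-dimensional Noetherian local ring `A`. -/
structure IsParamPair (x y : A) : Prop where
  max_eq : maximalIdeal A = Ideal.span {x, y}
  dim_eq : ringKrullDim A = 2

namespace IsParamPair

variable {x y : A}

theorem symm (h : IsParamPair x y) : IsParamPair y x :=
  ⟨by rw [h.max_eq, Set.pair_comm], h.dim_eq⟩

theorem left_mem (h : IsParamPair x y) : x ∈ maximalIdeal A := by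
  rw [h.max_eq]; exact Ideal.subset_span (by simp)

theorem right_mem (h : IsParamPair x y) : y ∈ maximalIdeal A := h.symm.left_mem

theorem mem_max_iff (h : IsParamPair x y) {a : A} :
    a ∈ maximalIdeal A ↔ ∃ b c, a = b * x + c * y := by
  rw [h.max_eq, Ideal.mem_span_pair]
  exact ⟨fun ⟨b, c, e⟩ => ⟨b, c, e.symm⟩, fun ⟨b, c, e⟩ => ⟨b, c, e.symm⟩⟩

theorem height_eq (h : IsParamPair x y) : (maximalIdeal A).height = 2 := by
  have := IsLocalRing.maximalIdeal_height_eq_ringKrullDim (R := A)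
  rw [h.dim_eq] at this
  exact WithBot.coe_injective this

variable [IsNoetherianRing A]

/-- By Krull's principal ideal theorem, `𝔪` is not the only prime ideal through an element. -/
theorem false_of_unique_prime (h : IsParamPair x y) {a : A} (ha : a ∈ maximalIdeal A)
    (hP : ∀ P : Ideal A, P.IsPrime → a ∈ P → P = maximalIdeal A) : False := by
  have : (Ideal.span {a}).minimalPrimes = {maximalIdeal A} := by
    refine (Set.Nonempty.subset_singleton_iff ?_).1 ?_
    · refine Set.nonempty_coe_sort.1 (Ideal.nonempty_minimalPrimes ?_)
      intro ht
      rw [Ideal.span_singleton_eq_top] at ht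
      exact ha ht
    · intro P hPm
      exact hP P hPm.1.1 (hPm.1.2 (Ideal.mem_span_singleton_self a))
  have h1 : (maximalIdeal A).height ≤ 1 :=
    Ideal.height_le_one_of_isPrincipal_of_mem_minimalPrimes (Ideal.span {a}) _
      (by rw [this]; rfl)
  rw [h.height_eq] at h1
  exact absurd h1 (by decide)

/-- An element outside `xA` is a unit times a power of `y`, modulo `x`: the ring `A / xA` is a
discrete valuation ring with uniformizer `y`. -/
theorem exists_unit_mul_pow (h : IsParamPair x y) {f : A} (hf : ¬ x ∣ f) :
    ∃ (k : ℕ) (u g : A), IsUnit u ∧ f = u * y ^ k + x * g := by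
  let I := Ideal.span {x}
  have hI : I ≠ ⊤ := by
    intro ht
    rw [Ideal.span_singleton_eq_top] at ht
    exact h.left_mem ht
  have : Nontrivial (A ⧸ I) := Ideal.Quotient.nontrivial_iff.2 hI
  have hloc : IsLocalRing (A ⧸ I) :=
    IsLocalRing.of_surjective' (Ideal.Quotient.mk I) Ideal.Quotient.mk_surjective
  have hf0 : Ideal.Quotient.mk I f ≠ 0 := by
    rwa [Ne, Ideal.Quotient.eq_zero_iff_mem, Ideal.mem_span_singleton]
  have hy : Ideal.span {Ideal.Quotient.mk I y} ≠ ⊤ := by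
    intro ht
    rw [Ideal.span_singleton_eq_top] at ht
    obtain ⟨w, hw⟩ := ht.exists_right_inv
    obtain ⟨w, rfl⟩ := Ideal.Quotient.mk_surjective w
    rw [← map_mul, ← map_one (Ideal.Quotient.mk I), Ideal.Quotient.eq,
      Ideal.mem_span_singleton] at hw
    obtain ⟨c, hc⟩ := hw
    have : (1 : A) ∈ maximalIdeal A := by
      have e : (1 : A) = w * y - c * x := by linear_combination -hc
      rw [e]
      exact Ideal.sub_mem _ (Ideal.mul_mem_left _ _ h.right_mem)
        (Ideal.mul_mem_left _ _ h.left_mem)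
    exact (Ideal.ne_top_iff_one _).1 (maximalIdeal.isMaximal A).ne_top this
  have hk : ∃ k, Ideal.Quotient.mk I f ∉ Ideal.span {Ideal.Quotient.mk I y} ^ (k + 1) := by
    by_contra! hcon
    apply hf0
    rw [← Ideal.mem_bot, ← Ideal.iInf_pow_eq_bot_of_isLocalRing _ hy, Ideal.mem_iInf]
    intro i
    exact Ideal.pow_le_pow_right (Nat.le_succ i) (hcon i)
  classical
  obtain ⟨hk1, hk2⟩ := And.intro (Nat.find_spec hk) (fun m => Nat.find_min hk (m := m))
  set k := Nat.find hk
  have hmem : Ideal.Quotient.mk I f ∈ Ideal.span {Ideal.Quotient.mk I y} ^ k := by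
    rcases Nat.eq_zero_or_pos k with h0 | h0
    · simp [h0]
    · have := hk2 (k - 1) (by omega)
      rw [not_not, Nat.sub_add_cancel h0] at this
      exact this
  rw [Ideal.span_singleton_pow, Ideal.mem_span_singleton] at hmem hk1
  obtain ⟨u, hu⟩ := hmem
  obtain ⟨u, rfl⟩ := Ideal.Quotient.mk_surjective u
  rw [← map_pow, ← map_mul, Ideal.Quotient.eq, Ideal.mem_span_singleton] at hu
  obtain ⟨g, hg⟩ := hu
  refine ⟨k, u, g, ?_, by linear_combination hg⟩
  by_contra hu
  obtain ⟨b, c, rfl⟩ := h.mem_max_iff.1 ((mem_maximalIdeal u).2 hu)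
  apply hk1
  refine ⟨Ideal.Quotient.mk I c, ?_⟩
  rw [← map_pow, ← map_mul, Ideal.Quotient.eq, Ideal.mem_span_singleton]
  exact ⟨g + y ^ k * b, by linear_combination hg⟩

theorem prime_left (h : IsParamPair x y) (h0 : x ≠ 0) : Prime x := by
  refine ⟨h0, h.left_mem, fun a b hab => ?_⟩
  by_contra! hcon
  obtain ⟨k, u, g, hu, rfl⟩ := h.exists_unit_mul_pow hcon.1
  obtain ⟨l, u', g', hu', rfl⟩ := h.exists_unit_mul_pow hcon.2
  obtain ⟨w, hw⟩ := (hu.mul hu').exists_left_inv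
  obtain ⟨d, hd⟩ := hab
  -- otherwise a power of `y` would lie in `xA`, and `A` would have dimension at most one
  have hpow : y ^ (k + l) = x * (w * (d - u * y ^ k * g' - g * (u' * y ^ l + x * g'))) := by
    rw [pow_add]
    linear_combination (-y ^ k * y ^ l) * hw + w * hd
  refine h.false_of_unique_prime h.left_mem fun P hP hxP => ?_
  have hyP : y ∈ P := hP.mem_of_pow_mem _ (hpow ▸ P.mul_mem_right _ hxP)
  refine le_antisymm (le_maximalIdeal hP.ne_top) ?_
  rw [h.max_eq, Ideal.span_le]
  rintro z (rfl | rfl) <;> assumption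

theorem not_dvd (h : IsParamPair x y) : ¬ x ∣ y := by
  rintro ⟨c, hc⟩
  refine h.false_of_unique_prime h.left_mem fun P hP hxP => ?_
  have hyP : y ∈ P := hc ▸ P.mul_mem_right _ hxP
  refine le_antisymm (le_maximalIdeal hP.ne_top) ?_
  rw [h.max_eq, Ideal.span_le]
  rintro z (rfl | rfl) <;> assumption

/-- A prime ideal through `x` but not through `y` is generated by `x`. -/
theorem mem_prime_iff_dvd (h : IsParamPair x y) {P : Ideal A} (hP : P.IsPrime) (hx : x ∈ P)
    (hy : y ∉ P) {a : A} : a ∈ P ↔ x ∣ a := by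
  refine ⟨fun ha => ?_, fun ⟨c, hc⟩ => hc ▸ P.mul_mem_right _ hx⟩
  by_contra hcon
  obtain ⟨k, u, g, hu, rfl⟩ := h.exists_unit_mul_pow hcon
  have h1 : u * y ^ k ∈ P := (P.add_mem_iff_left (P.mul_mem_right _ hx)).1 ha
  rcases hP.mem_or_mem h1 with h2 | h2
  · exact hP.ne_top (P.eq_top_of_isUnit_mem h2 hu)
  · exact hy (hP.mem_of_pow_mem _ h2)

theorem left_ne_zero (h : IsParamPair x y) : x ≠ 0 := by
  rintro rfl
  refine h.false_of_unique_prime h.right_mem fun P hP hyP => ?_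
  refine le_antisymm (le_maximalIdeal hP.ne_top) ?_
  rw [h.max_eq, Ideal.span_le]
  rintro z (rfl | rfl)
  · exact P.zero_mem
  · exact hyP

theorem ne_zero_right (h : IsParamPair x y) : y ≠ 0 := h.symm.left_ne_zero

theorem prime (h : IsParamPair x y) : Prime x := h.prime_left h.left_ne_zero

variable [IsDomain A]

/-- Every non-maximal prime ideal of `A` is principal: an element generating it modulo `x`
generates it, by Nakayama's lemma. -/
theorem exists_eq_span (h : IsParamPair x y) {P : Ideal A} (hP : P.IsPrime)
    (hne : P ≠ maximalIdeal A) : ∃ p, P = Ideal.span {p} := by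
  by_cases hx : x ∈ P
  · have hy : y ∉ P := by
      intro hy
      refine hne (le_antisymm (le_maximalIdeal hP.ne_top) ?_)
      rw [h.max_eq, Ideal.span_le]
      rintro z (rfl | rfl) <;> assumption
    refine ⟨x, ?_⟩
    ext a
    rw [h.mem_prime_iff_dvd hP hx hy, Ideal.mem_span_singleton]
  · by_cases hbot : P = ⊥
    · exact ⟨0, by simp [hbot]⟩
    obtain ⟨a₀, ha₀P, ha₀⟩ := Submodule.exists_mem_ne_zero_of_ne_bot hbot
    -- some element of `P` is not divisible by `x`
    have hdiv : ∀ n (a : A), a ∈ P → ¬ x ^ n ∣ a → ∃ b ∈ P, ¬ x ∣ b := by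
      intro n
      induction n with
      | zero => intro a _ ha; exact absurd (by simp) ha
      | succ n ih =>
        intro a ha hn
        by_cases hxa : x ∣ a
        · obtain ⟨b, rfl⟩ := hxa
          have hb := (hP.mem_or_mem ha).resolve_left hx
          exact ih b hb fun hd => hn (by rw [pow_succ']; exact mul_dvd_mul_left x hd)
        · exact ⟨a, ha, hxa⟩
    have hfin : FiniteMultiplicity x a₀ := FiniteMultiplicity.of_not_isUnit h.left_mem ha₀
    obtain ⟨n, hn⟩ := hfin
    obtain ⟨b, hbP, hb⟩ := hdiv _ a₀ ha₀P hn
    have hex : ∃ k, ∃ u g, IsUnit u ∧ u * y ^ k + x * g ∈ P := by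
      obtain ⟨k, u, g, hu, rfl⟩ := h.exists_unit_mul_pow hb
      exact ⟨k, u, g, hu, hbP⟩
    classical
    obtain ⟨u, g, hu, hmem⟩ := Nat.find_spec hex
    have hmin := fun m => Nat.find_min hex (m := m)
    set k := Nat.find hex
    set p := u * y ^ k + x * g with hp
    obtain ⟨w, hw⟩ := hu.exists_left_inv
    refine ⟨p, le_antisymm ?_ ((Ideal.span_singleton_le_iff_mem _).2 hmem)⟩
    have hle : P ≤ Ideal.span {p} ⊔ maximalIdeal A • P := by
      intro a ha
      have key : ∃ c d, a = c * p + x * d := by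
        by_cases hxa : x ∣ a
        · obtain ⟨d, rfl⟩ := hxa
          exact ⟨0, d, by ring⟩
        · obtain ⟨l, u', g', hu', rfl⟩ := h.exists_unit_mul_pow hxa
          have hkl : k ≤ l := by
            by_contra! hlt
            exact hmin l hlt ⟨u', g', hu', ha⟩
          refine ⟨u' * w * y ^ (l - k), g' - u' * w * y ^ (l - k) * g, ?_⟩
          rw [hp]
          have e : y ^ l = y ^ (l - k) * y ^ k := by rw [← pow_add, Nat.sub_add_cancel hkl]
          rw [e]
          linear_combination (-u' * y ^ (l - k) * y ^ k) * hw
      obtain ⟨c, d, rfl⟩ := key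
      have hd : d ∈ P := by
        have := (P.add_mem_iff_right (P.mul_mem_left c hmem)).1 ha
        exact (hP.mem_or_mem this).resolve_left hx
      exact Ideal.add_mem _ (Ideal.mem_sup_left (Ideal.mem_span_singleton'.2 ⟨c, rfl⟩))
        (Ideal.mem_sup_right (Submodule.smul_mem_smul h.left_mem hd))
    exact Submodule.le_of_le_smul_of_le_jacobson_bot (IsNoetherian.noetherian P)
      (by rw [IsLocalRing.jacobson_eq_maximalIdeal ⊥ bot_ne_top]) hle

theorem ufd (h : IsParamPair x y) : UniqueFactorizationMonoid A := by
  rw [UniqueFactorizationMonoid.iff_exists_prime_mem_of_isPrime]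
  intro P hP0 hP
  by_cases hne : P = maximalIdeal A
  · exact ⟨x, hne ▸ h.left_mem, h.prime⟩
  · obtain ⟨p, rfl⟩ := h.exists_eq_span hP hne
    have hp : p ≠ 0 := by
      rintro rfl
      exact hP0 (by simp)
    exact ⟨p, Ideal.mem_span_singleton_self p, (Ideal.span_singleton_prime hp).1 hP⟩

end IsParamPair

variable [IsNoetherianRing A]

/-- A Noetherian local domain whose maximal ideal is generated by a prime element `x` and an
element outside `xA` is regular of dimension two. -/
theorem isParamPair_of_prime [IsDomain A] {x y : A} (hm : maximalIdeal A = Ideal.span {x, y})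
    (hx : Prime x) (hxy : ¬ x ∣ y) : IsRegularLocalRing A ∧ IsParamPair x y := by
  have hle : (maximalIdeal A).spanFinrank ≤ 2 := by
    rw [hm]
    exact (Submodule.spanFinrank_span_le_ncard_of_finite (by simp)).trans
      ((Set.ncard_insert_le x {y}).trans (by simp))
  have hdim : (2 : WithBot ℕ∞) ≤ ringKrullDim A := by
    have : (Ideal.span {x}).IsPrime := (Ideal.span_singleton_prime hx.ne_zero).2 hx
    have h1 : (⊥ : Ideal A) < Ideal.span {x} := by
      rw [bot_lt_iff_ne_bot, Ne, Ideal.span_singleton_eq_bot]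
      exact hx.ne_zero
    have h2 : Ideal.span {x} < maximalIdeal A := by
      refine lt_of_le_of_ne (le_maximalIdeal (Ideal.IsPrime.ne_top ‹_›)) fun he => hxy ?_
      rw [← Ideal.mem_span_singleton, he, hm]
      exact Ideal.subset_span (by simp)
    have h3 := Ideal.height_add_one_le_of_lt_of_isPrime h1
    have h4 := Ideal.height_add_one_le_of_lt_of_isPrime h2
    rw [← IsLocalRing.maximalIdeal_height_eq_ringKrullDim]
    have h5 : (2 : ℕ∞) ≤ (maximalIdeal A).height := by
      refine le_trans ?_ h4
      refine le_trans ?_ (add_le_add_left h3 1)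
      rw [add_assoc, one_add_one_eq_two]
      exact le_add_self
    exact WithBot.coe_le_coe.2 h5
  have hdim' : ringKrullDim A ≤ 2 :=
    (ringKrullDim_le_spanFinrank_maximalIdeal A).trans (by exact_mod_cast hle)
  refine ⟨IsRegularLocalRing.of_spanFinrank_maximalIdeal_le A (le_trans ?_ hdim),
    hm, le_antisymm hdim' hdim⟩
  exact_mod_cast hle

theorem mem_pow_elemOrd {f : A} (hf : f ≠ 0) :
    f ∈ maximalIdeal A ^ elemOrd f ∧ f ∉ maximalIdeal A ^ (elemOrd f + 1) := by
  have hk : ∃ k, f ∉ maximalIdeal A ^ (k + 1) := by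
    by_contra! hcon
    apply hf
    rw [← Ideal.mem_bot, ← Ideal.iInf_pow_eq_bot_of_isLocalRing (maximalIdeal A)
      (maximalIdeal.isMaximal A).ne_top, Ideal.mem_iInf]
    intro i
    exact Ideal.pow_le_pow_right (Nat.le_succ i) (hcon i)
  classical
  obtain ⟨hk1, hk2⟩ := And.intro (Nat.find_spec hk) (fun m => Nat.find_min hk (m := m))
  set k := Nat.find hk
  have hmem : f ∈ maximalIdeal A ^ k := by
    rcases Nat.eq_zero_or_pos k with h0 | h0
    · simp [h0]
    · have := hk2 (k - 1) (by omega)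
      rw [not_not, Nat.sub_add_cancel h0] at this
      exact this
  rw [elemOrd_eq hmem hk1]
  exact ⟨hmem, hk1⟩

theorem le_elemOrd {f : A} (hf : f ≠ 0) {n : ℕ} : n ≤ elemOrd f ↔ f ∈ maximalIdeal A ^ n := by
  refine ⟨fun h => Ideal.pow_le_pow_right h (mem_pow_elemOrd hf).1, fun h => ?_⟩
  by_contra! hlt
  exact (mem_pow_elemOrd hf).2 (Ideal.pow_le_pow_right hlt h)

theorem idealOrd_span_singleton [IsDomain A] {f : A} (hf : f ≠ 0) :
    idealOrd (Ideal.span {f}) = elemOrd f := by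
  have hmem : elemOrd f ∈ {n : ℕ | ∃ g ∈ Ideal.span {f}, g ≠ 0 ∧ elemOrd g = n} :=
    ⟨f, Ideal.mem_span_singleton_self f, hf, rfl⟩
  refine le_antisymm (Nat.sInf_le hmem) (le_csInf ⟨_, hmem⟩ ?_)
  rintro n ⟨g, hg, hg0, rfl⟩
  obtain ⟨c, rfl⟩ := Ideal.mem_span_singleton.1 hg
  exact (le_elemOrd hg0).2 (Ideal.mul_mem_right _ _ (mem_pow_elemOrd hf).1)

end LocalAlgebra

theorem exists_isParamPair {A : Type*} [CommRing A] [IsRegularLocalRing A]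
    (h : ringKrullDim A = 2) :
    ∃ x y : A, IsParamPair x y := by
  have h1 : (maximalIdeal A).spanFinrank = 2 := by
    have := IsRegularLocalRing.spanFinrank_maximalIdeal (R := A)
    rw [h] at this
    exact_mod_cast this
  have hfg : (maximalIdeal A).FG := IsNoetherian.noetherian _
  have h2 := Submodule.FG.generators_ncard hfg
  rw [h1, Set.ncard_eq_two] at h2
  obtain ⟨x, y, -, hxy⟩ := h2
  exact ⟨x, y, by rw [Ideal.span, ← hxy, Submodule.span_generators], h⟩

/-! ### Factorial domains: strict transforms of principal ideals -/

section Strict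

variable {A B : Type*} [CommRing A] [CommRing B] [IsDomain B] [UniqueFactorizationMonoid B]

/-- Splitting off the prime factors with a given property. -/
theorem exists_eq_mul_prime_split {f : B} (hf : f ≠ 0) (E : B → Prop) :
    ∃ c g : B, f = c * g ∧ (∀ q, Prime q → q ∣ c → ∃ q', Associated q q' ∧ E q') ∧
      (∀ q, Prime q → q ∣ g → ∃ q', Associated q q' ∧ ¬ E q') := by
  induction f using UniqueFactorizationMonoid.induction_on_prime with
  | h₁ => exact absurd rfl hf
  | h₂ u hu =>
    exact ⟨1, u, by simp, fun q hq hd => absurd (isUnit_of_dvd_one hd) hq.not_isUnit,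
      fun q hq hd => absurd (isUnit_of_dvd_unit hd hu) hq.not_isUnit⟩
  | h₃ a p ha hp ih =>
    obtain ⟨c, g, rfl, h1, h2⟩ := ih ha
    by_cases hE : E p
    · refine ⟨p * c, g, by ring, fun q hq hd => ?_, h2⟩
      rcases hq.dvd_or_dvd hd with h | h
      · exact ⟨p, (hq.associated_of_dvd hp h), hE⟩
      · exact h1 q hq h
    · refine ⟨c, p * g, by ring, h1, fun q hq hd => ?_⟩
      rcases hq.dvd_or_dvd hd with h | h
      · exact ⟨p, (hq.associated_of_dvd hp h), hE⟩
      · exact h2 q hq h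

/-- If `f = c g` where all prime factors of `c` and none of those of `g` are exceptional, then the
strict transform of the principal ideal `fA` is `gB`. -/
theorem strictTransform_eq_span {φ : A →+* B} {f : A} {c g : B} (hc0 : c ≠ 0)
    (hf : φ f = c * g) (hc : ∀ q, Prime q → q ∣ c → IsExceptionalPrime φ q)
    (hg : ∀ q, Prime q → q ∣ g → ¬ IsExceptionalPrime φ q) :
    strictTransform φ (Ideal.span {f}) = Ideal.span {g} := by
  apply le_antisymm
  · refine sSup_le ?_
    rintro J ⟨d, hd0, hd, hJ⟩
    rw [Ideal.map_span, Set.image_singleton, hf] at hJ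
    have hcop : IsRelPrime d g := by
      refine (UniqueFactorizationMonoid.isRelPrime_iff_no_prime_factors hd0).2 ?_
      exact fun q hqd hqg hq => hg q hq hqg (hd q hq hqd)
    have hdc : d ∣ c := by
      refine hcop.dvd_of_dvd_mul_right ?_
      rw [← Ideal.mem_span_singleton]
      exact (hJ.trans_le Ideal.mul_le_left) (Ideal.mem_span_singleton_self _)
    obtain ⟨e, rfl⟩ := hdc
    intro j hj
    have h1 : d * j ∈ Ideal.span {d * e * g} := by
      rw [hJ]
      exact Ideal.mul_mem_mul (Ideal.mem_span_singleton_self d) hj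
    obtain ⟨w, hw⟩ := Ideal.mem_span_singleton.1 h1
    rw [Ideal.mem_span_singleton]
    exact ⟨e * w, mul_left_cancel₀ hd0 (by rw [hw]; ring)⟩
  · refine le_sSup ⟨c, hc0, hc, ?_⟩
    rw [Ideal.map_span, Set.image_singleton, hf, Ideal.span_singleton_mul_span_singleton]

end Strict

/-! ### Polynomials in a quotient of two parameters -/

namespace Point

variable {K : Type*} [Field K]

instance (S : Point K) : IsFractionRing S.ring K := S.isFractionRing

theorem exists_params (S : Point K) : ∃ x y : S.ring, IsParamPair x y :=
  exists_isParamPair S.dim_eq_two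

instance (S : Point K) : UniqueFactorizationMonoid S.ring :=
  let ⟨_, _, h⟩ := S.exists_params
  h.ufd

theorem exists_div (S : Point K) (z : K) : ∃ a b : S.ring, b ≠ 0 ∧ z = (a : K) / (b : K) := by
  obtain ⟨a, b, hb, rfl⟩ := IsFractionRing.div_surjective (A := S.ring) z
  exact ⟨a, b, nonZeroDivisors.ne_zero hb, rfl⟩

theorem coe_ne_zero {S : Point K} {a : S.ring} : (a : K) ≠ 0 ↔ a ≠ 0 := by simp

/-- The maximal ideal of a point, as a subset of the field. -/
def maxSet (S : Point K) : Set K := {a | ∃ h : a ∈ S.ring, (⟨a, h⟩ : S.ring) ∈ maximalIdeal S.ring}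

variable {S T : Point K}

theorem coe_mem_maxSet {a : S.ring} : (a : K) ∈ S.maxSet ↔ a ∈ maximalIdeal S.ring :=
  ⟨fun ⟨_, h⟩ => h, fun h => ⟨a.2, h⟩⟩

theorem add_mem_maxSet {a b : K} (ha : a ∈ S.maxSet) (hb : b ∈ S.maxSet) : a + b ∈ S.maxSet :=
  ⟨S.ring.add_mem ha.1 hb.1, Ideal.add_mem _ ha.2 hb.2⟩

theorem sub_mem_maxSet {a b : K} (ha : a ∈ S.maxSet) (hb : b ∈ S.maxSet) : a - b ∈ S.maxSet :=
  ⟨S.ring.sub_mem ha.1 hb.1, Ideal.sub_mem _ ha.2 hb.2⟩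

theorem mul_mem_maxSet {a b : K} (ha : a ∈ S.ring) (hb : b ∈ S.maxSet) : a * b ∈ S.maxSet :=
  ⟨S.ring.mul_mem ha hb.1, Ideal.mul_mem_left _ ⟨a, ha⟩ hb.2⟩

theorem mem_or_mem_maxSet {a b : K} (ha : a ∈ S.ring) (hb : b ∈ S.ring) (h : a * b ∈ S.maxSet) :
    a ∈ S.maxSet ∨ b ∈ S.maxSet := by
  have h2 : (⟨a, ha⟩ * ⟨b, hb⟩ : S.ring) ∈ maximalIdeal S.ring := h.2
  rcases (Ideal.IsPrime.mem_or_mem (maximalIdeal.isMaximal S.ring).isPrime h2) with h | h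
  exacts [Or.inl ⟨_, h⟩, Or.inr ⟨_, h⟩]

theorem one_notMem_maxSet : (1 : K) ∉ S.maxSet :=
  fun h => h.2 isUnit_one

theorem inv_mem_of_notMem_maxSet {a : K} (ha : a ∈ S.ring) (h : a ∉ S.maxSet) : a⁻¹ ∈ S.ring := by
  have hu : IsUnit (⟨a, ha⟩ : S.ring) := by
    by_contra hu
    exact h ⟨ha, (mem_maximalIdeal _).2 hu⟩
  obtain ⟨b, hb⟩ := hu.exists_right_inv
  have hb' : a * b = 1 := congrArg Subtype.val hb
  rw [← eq_inv_of_mul_eq_one_right hb']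
  exact b.2

theorem notMem_maxSet_of_inv_mem {a : K} (h0 : a ≠ 0) (h : a⁻¹ ∈ S.ring) : a ∉ S.maxSet := by
  intro hm
  apply one_notMem_maxSet (S := S)
  rw [← inv_mul_cancel₀ h0]
  exact mul_mem_maxSet h hm

theorem isUnit_iff_notMem_maxSet {a : S.ring} : IsUnit a ↔ (a : K) ∉ S.maxSet := by
  rw [coe_mem_maxSet, mem_maximalIdeal, mem_nonunits_iff, not_not]

/-- A point is not a valuation ring. -/
theorem exists_notMem_inv_notMem (S : Point K) : ∃ z : K, z ∉ S.ring ∧ z⁻¹ ∉ S.ring := by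
  obtain ⟨x, y, h⟩ := S.exists_params
  have key : ∀ a b : S.ring, a ≠ 0 → ¬ a ∣ b → (b : K) / a ∉ S.ring := fun a b ha hab hm =>
    hab ⟨⟨_, hm⟩, Subtype.ext (by
      rw [Subring.coe_mul]; exact (mul_div_cancel₀ _ (coe_ne_zero.2 ha)).symm)⟩
  refine ⟨(y : K) / x, key x y h.left_ne_zero h.not_dvd, ?_⟩
  rw [inv_div]
  exact key y x h.symm.left_ne_zero h.symm.not_dvd

/-- Evaluation of polynomials over a point at an element of the field. -/
def ev (S : Point K) (t : K) : S.ring[X] →+* K := eval₂RingHom S.ring.subtype t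

/-- Reduction of polynomials over a point modulo its maximal ideal. -/
def red (S : Point K) : S.ring[X] →+* (ResidueField S.ring)[X] := mapRingHom (residue S.ring)

theorem ev_X (S : Point K) (t : K) : S.ev t X = t := eval₂_X _ _

theorem ev_C (S : Point K) (t : K) (a : S.ring) : S.ev t (C a) = a := eval₂_C _ _

theorem red_X (S : Point K) : S.red X = X := Polynomial.map_X _

theorem red_C (S : Point K) (a : S.ring) : S.red (C a) = C (residue S.ring a) := Polynomial.map_C _

theorem coeff_red (A : S.ring[X]) (i : ℕ) : (S.red A).coeff i = residue S.ring (A.coeff i) :=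
  Polynomial.coeff_map _ _

theorem red_eq_zero_iff {A : S.ring[X]} :
    S.red A = 0 ↔ ∀ i, A.coeff i ∈ maximalIdeal S.ring := by
  simp_rw [Polynomial.ext_iff, coeff_red, coeff_zero, residue_eq_zero_iff]

theorem red_surjective (S : Point K) : Function.Surjective S.red :=
  Polynomial.map_surjective _ (residue_surjective)

theorem ev_mem {t : K} (h : S ≤ T) (ht : t ∈ T.ring) (A : S.ring[X]) : S.ev t A ∈ T.ring := by
  have : S.ev t A = ∑ i ∈ A.support, ((A.coeff i : K) * t ^ i) := by
    change eval₂ _ _ A = _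
    rw [eval₂_eq_sum, Polynomial.sum]
    rfl
  rw [this]
  exact T.ring.sum_mem fun i _ => T.ring.mul_mem (h (A.coeff i).2) (T.ring.pow_mem ht i)

/-- By Gauss's lemma, a polynomial vanishing at the quotient `y / x` of two coprime non-units is a
multiple of `xX - y`; hence all its coefficients are non-units. -/
theorem red_eq_zero_of_ev_eq_zero {x y : S.ring} (hx : x ∈ maximalIdeal S.ring)
    (hy : y ∈ maximalIdeal S.ring) (hx0 : x ≠ 0) (hrel : IsRelPrime x y) {A : S.ring[X]}
    (h : S.ev ((y : K) / x) A = 0) : S.red A = 0 := by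
  have hprim : (C x * X - C y).IsPrimitive := by
    intro r hr
    obtain ⟨Q, hQ⟩ := hr
    refine hrel ⟨Q.coeff 1, ?_⟩ (dvd_neg.1 ⟨Q.coeff 0, ?_⟩)
    · have := congrArg (fun P => coeff P 1) hQ
      simpa [coeff_C] using this
    · have := congrArg (fun P => coeff P 0) hQ
      simpa using this
  let := Classical.choice (inferInstance : Nonempty (NormalizedGCDMonoid S.ring))
  have hdvd : (C x * X - C y) ∣ A := by
    refine hprim.dvd_of_fraction_map_dvd_fraction_map (K := K) ?_
    have hx0' : (x : K) ≠ 0 := coe_ne_zero.2 hx0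
    have hroot : IsRoot (A.map (algebraMap S.ring K)) ((y : K) / x) := by
      rw [IsRoot, eval_map]
      exact h
    obtain ⟨Q, hQ⟩ := dvd_iff_isRoot.2 hroot
    refine ⟨C (x : K)⁻¹ * Q, ?_⟩
    rw [hQ]
    have e1 : (C x * X - C y).map (algebraMap S.ring K) = C (x : K) * (X - C ((y : K) / x)) := by
      rw [mul_sub, ← C_mul, mul_div_cancel₀ _ hx0', Polynomial.map_sub, Polynomial.map_mul,
        Polynomial.map_C, Polynomial.map_C, Polynomial.map_X]
      rfl
    rw [e1]
    have e2 : C (x : K) * C (x : K)⁻¹ = 1 := by rw [← C_mul, mul_inv_cancel₀ hx0', C_1]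
    linear_combination (-(X - C ((y : K) / x)) * Q) * e2
  obtain ⟨Q, rfl⟩ := hdvd
  rw [map_mul, map_sub, map_mul, red_C, red_C, (residue_eq_zero_iff _).2 hx,
    (residue_eq_zero_iff _).2 hy]
  simp

end Point

namespace IsParamPair

open Point

variable {K : Type*} [Field K] {S : Point K} {x y : S.ring}

theorem isRelPrime (h : IsParamPair x y) : IsRelPrime x y :=
  h.prime.irreducible.isRelPrime_iff_not_dvd.2 h.not_dvd

theorem coe_ne_zero (h : IsParamPair x y) : (x : K) ≠ 0 := Point.coe_ne_zero.2 h.left_ne_zero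

theorem red_eq_zero (h : IsParamPair x y) {A : S.ring[X]} (hA : S.ev ((y : K) / x) A = 0) :
    S.red A = 0 :=
  red_eq_zero_of_ev_eq_zero h.left_mem h.right_mem h.left_ne_zero h.isRelPrime hA

theorem exists_ev_eq_mul (h : IsParamPair x y) {A : S.ring[X]} (hA : S.red A = 0) :
    ∃ B, S.ev ((y : K) / x) A = x * S.ev ((y : K) / x) B := by
  have h1 : A ∈ (maximalIdeal S.ring).map C := Ideal.mem_map_C_iff.2 (red_eq_zero_iff.1 hA)
  rw [h.max_eq, Ideal.map_span, Set.image_pair, Ideal.mem_span_pair] at h1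
  obtain ⟨B, D, rfl⟩ := h1
  refine ⟨B + X * D, ?_⟩
  simp only [map_add, map_mul, ev_C, ev_X]
  have := h.coe_ne_zero
  field_simp

/-- Polynomials with values congruent modulo `xS[t]` at `t = y / x` have the same reduction, so
`S[t] / xS[t]` is the polynomial ring over the residue field. -/
theorem red_eq_of_ev_eq_mul (h : IsParamPair x y) {A B D : S.ring[X]}
    (hAB : S.ev ((y : K) / x) A = S.ev ((y : K) / x) B + x * S.ev ((y : K) / x) D) :
    S.red A = S.red B := by
  have h1 : S.ev ((y : K) / x) (A - (B + C x * D)) = 0 := by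
    rw [map_sub, map_add, map_mul, ev_C, hAB, sub_self]
  have h2 := h.red_eq_zero h1
  rw [map_sub, map_add, map_mul, red_C, (residue_eq_zero_iff _).2 h.left_mem] at h2
  simpa [sub_eq_zero] using h2

theorem red_eq_of_ev_eq (h : IsParamPair x y) {A B : S.ring[X]}
    (hAB : S.ev ((y : K) / x) A = S.ev ((y : K) / x) B) : S.red A = S.red B :=
  h.red_eq_of_ev_eq_mul (D := 0) (by simp [hAB])

theorem ev_ne_zero (h : IsParamPair x y) {A : S.ring[X]} (hA : S.red A ≠ 0) :
    S.ev ((y : K) / x) A ≠ 0 := fun h0 => hA (h.red_eq_zero h0)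

/-! ### Leading forms -/

/-- The elements of `𝔪 ^ n` are the forms of degree `n` in `x` and `y`. -/
theorem exists_form (h : IsParamPair x y) {n : ℕ} {a : S.ring} (ha : a ∈ maximalIdeal S.ring ^ n) :
    ∃ A : S.ring[X], A.natDegree ≤ n ∧ (a : K) = (x : K) ^ n * S.ev ((y : K) / x) A := by
  have hx := h.coe_ne_zero
  induction n generalizing a with
  | zero => exact ⟨C a, by simp, by simp [ev_C]⟩
  | succ n ih =>
    rw [pow_succ] at ha
    refine Submodule.mul_induction_on ha ?_ ?_
    · intro b hb c hc
      obtain ⟨B, hB, hbB⟩ := ih hb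
      obtain ⟨d, e, rfl⟩ := h.mem_max_iff.1 hc
      refine ⟨B * (C d + C e * X), ?_, ?_⟩
      · refine natDegree_mul_le.trans (add_le_add hB ?_)
        exact (natDegree_add_le _ _).trans (max_le (by simp)
          ((natDegree_C_mul_le e X).trans natDegree_X_le))
      · rw [map_mul, map_add, map_mul, ev_C, ev_C, ev_X, Subring.coe_mul, hbB, Subring.coe_add,
          Subring.coe_mul, Subring.coe_mul]
        field_simp
        ring
    · rintro a b ⟨A, hA, ha⟩ ⟨B, hB, hb⟩
      exact ⟨A + B, natDegree_add_le_of_degree_le hA hB, by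
        rw [map_add, Subring.coe_add, ha, hb, mul_add]⟩

/-- A form of degree `n` with coefficients in `J` is an element of `J𝔪ⁿ`. -/
theorem exists_eq_form (h : IsParamPair x y) {n : ℕ} {A : S.ring[X]} (hA : A.natDegree ≤ n)
    (J : Ideal S.ring) (hJ : ∀ i, A.coeff i ∈ J) :
    ∃ a ∈ J * maximalIdeal S.ring ^ n, (a : K) = (x : K) ^ n * S.ev ((y : K) / x) A := by
  have hx := h.coe_ne_zero
  refine ⟨∑ i ∈ Finset.range (n + 1), A.coeff i * (x ^ (n - i) * y ^ i), ?_, ?_⟩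
  · refine Ideal.sum_mem _ fun i hi => Ideal.mul_mem_mul (hJ i) ?_
    have e : maximalIdeal S.ring ^ n
        = maximalIdeal S.ring ^ (n - i) * maximalIdeal S.ring ^ i := by
      rw [← pow_add, Nat.sub_add_cancel (Nat.lt_succ_iff.1 (Finset.mem_range.1 hi))]
    rw [e]
    exact Ideal.mul_mem_mul (Ideal.pow_mem_pow h.left_mem _) (Ideal.pow_mem_pow h.right_mem _)
  · have : S.ev ((y : K) / x) A
        = ∑ i ∈ Finset.range (n + 1), (A.coeff i : K) * ((y : K) / x) ^ i := by
      change eval₂ _ _ A = _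
      rw [eval₂_eq_sum_range' _ (Nat.lt_succ_of_le hA)]
      rfl
    rw [this, Finset.mul_sum, AddSubmonoidClass.coe_finsetSum]
    refine Finset.sum_congr rfl fun i hi => ?_
    have e : (x : K) ^ n = (x : K) ^ (n - i) * (x : K) ^ i := by
      rw [← pow_add, Nat.sub_add_cancel (Nat.lt_succ_iff.1 (Finset.mem_range.1 hi))]
    rw [e, div_pow]
    push_cast
    field_simp

theorem red_eq_zero_of_mem_pow (h : IsParamPair x y) {n : ℕ} {A : S.ring[X]} {a : S.ring}
    (ha : (a : K) = (x : K) ^ n * S.ev ((y : K) / x) A)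
    (hm : a ∈ maximalIdeal S.ring ^ (n + 1)) : S.red A = 0 := by
  obtain ⟨B, -, hB⟩ := h.exists_form hm
  have h1 : S.ev ((y : K) / x) A = S.ev ((y : K) / x) 0 + x * S.ev ((y : K) / x) B := by
    apply mul_left_cancel₀ (pow_ne_zero n h.coe_ne_zero)
    rw [← ha, hB, map_zero]
    ring
  rw [h.red_eq_of_ev_eq_mul h1, map_zero]

theorem elemOrd_eq_of_form (h : IsParamPair x y) {n : ℕ} {A : S.ring[X]} {a : S.ring}
    (hA : A.natDegree ≤ n) (hr : S.red A ≠ 0)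
    (ha : (a : K) = (x : K) ^ n * S.ev ((y : K) / x) A) : elemOrd a = n := by
  obtain ⟨b, hb, hb'⟩ := h.exists_eq_form hA ⊤ (by simp)
  rw [Ideal.top_mul] at hb
  obtain rfl : a = b := Subtype.ext (ha.trans hb'.symm)
  exact elemOrd_eq hb fun hm => hr (h.red_eq_zero_of_mem_pow ha hm)

/-- The leading form of a nonzero element. -/
theorem exists_leading_form (h : IsParamPair x y) {a : S.ring} (ha : a ≠ 0) :
    ∃ A : S.ring[X], A.natDegree ≤ elemOrd a ∧ S.red A ≠ 0 ∧
      (a : K) = (x : K) ^ elemOrd a * S.ev ((y : K) / x) A := by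
  obtain ⟨h1, h2⟩ := mem_pow_elemOrd ha
  obtain ⟨A, hA, haA⟩ := h.exists_form h1
  refine ⟨A, hA, fun hr => h2 ?_, haA⟩
  obtain ⟨b, hb, hb'⟩ := h.exists_eq_form hA _ (red_eq_zero_iff.1 hr)
  obtain rfl : a = b := Subtype.ext (haA.trans hb'.symm)
  rwa [pow_succ']

end IsParamPair

/-! ### The order valuation -/

namespace IsParamPair

open Point

variable {K : Type*} [Field K] {S : Point K} {x y : S.ring}

/-- The order valuation ring is the localization of `S[y / x]` at the prime ideal `xS[y / x]`. -/
theorem mem_orderValuationRing_iff (h : IsParamPair x y) {z : K} :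
    z ∈ S.orderValuationRing ↔ ∃ A B : S.ring[X], S.red B ≠ 0 ∧
      z = S.ev ((y : K) / x) A / S.ev ((y : K) / x) B := by
  have hx := h.coe_ne_zero
  constructor
  · rintro ⟨a, b, hb, hab, rfl⟩
    rcases eq_or_ne a 0 with rfl | ha
    · exact ⟨0, 1, by simp, by simp⟩
    obtain ⟨A, -, -, hA⟩ := h.exists_leading_form ha
    obtain ⟨B, -, hB0, hB⟩ := h.exists_leading_form hb
    have hle := hab.resolve_left ha
    refine ⟨C (x ^ (elemOrd a - elemOrd b)) * A, B, hB0, ?_⟩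
    have e : (x : K) ^ elemOrd a = (x : K) ^ (elemOrd a - elemOrd b) * (x : K) ^ elemOrd b := by
      rw [← pow_add, Nat.sub_add_cancel hle]
    rw [map_mul, ev_C, hA, hB, e]
    push_cast
    have := h.ev_ne_zero hB0
    field_simp
  · rintro ⟨A, B, hB, rfl⟩
    obtain ⟨a, ha, ha'⟩ := h.exists_eq_form (le_max_left A.natDegree B.natDegree) ⊤ (by simp)
    obtain ⟨b, hb, hb'⟩ := h.exists_eq_form (le_max_right A.natDegree B.natDegree) ⊤ (by simp)
    have hb0 : b ≠ 0 := by
      rintro rfl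
      exact mul_ne_zero (pow_ne_zero _ hx) (h.ev_ne_zero hB) hb'.symm
    refine ⟨a, b, hb0, ?_, ?_⟩
    · rw [h.elemOrd_eq_of_form (le_max_right _ _) hB hb']
      by_cases ha0 : a = 0
      · exact Or.inl ha0
      · rw [Ideal.top_mul] at ha
        exact Or.inr ((le_elemOrd ha0).2 ha)
    · rw [ha', hb', mul_div_mul_left _ _ (pow_ne_zero _ hx)]

end IsParamPair

namespace Point

variable {K : Type*} [Field K]

/-- The valuation ring of the order valuation of a point. -/
def orderVal (S : Point K) : ValuationSubring K where
  carrier := S.orderValuationRing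
  one_mem' := ⟨1, 1, one_ne_zero, Or.inr le_rfl, by simp⟩
  zero_mem' := ⟨0, 1, one_ne_zero, Or.inl rfl, by simp⟩
  neg_mem' := by
    obtain ⟨x, y, h⟩ := S.exists_params
    intro z hz
    obtain ⟨A, B, hB, rfl⟩ := h.mem_orderValuationRing_iff.1 hz
    exact h.mem_orderValuationRing_iff.2 ⟨-A, B, hB, by rw [map_neg, neg_div]⟩
  add_mem' := by
    obtain ⟨x, y, h⟩ := S.exists_params
    intro z w hz hw
    obtain ⟨A, B, hB, rfl⟩ := h.mem_orderValuationRing_iff.1 hz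
    obtain ⟨C, D, hD, rfl⟩ := h.mem_orderValuationRing_iff.1 hw
    refine h.mem_orderValuationRing_iff.2 ⟨A * D + B * C, B * D, ?_, ?_⟩
    · rw [map_mul]
      exact mul_ne_zero hB hD
    · simp only [map_add, map_mul]
      exact div_add_div _ _ (h.ev_ne_zero hB) (h.ev_ne_zero hD)
  mul_mem' := by
    obtain ⟨x, y, h⟩ := S.exists_params
    intro z w hz hw
    obtain ⟨A, B, hB, rfl⟩ := h.mem_orderValuationRing_iff.1 hz
    obtain ⟨C, D, hD, rfl⟩ := h.mem_orderValuationRing_iff.1 hw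
    refine h.mem_orderValuationRing_iff.2 ⟨A * C, B * D, ?_, ?_⟩
    · rw [map_mul]
      exact mul_ne_zero hB hD
    · simp only [map_mul]
      exact div_mul_div_comm _ _ _ _
  mem_or_inv_mem' := by
    intro z
    obtain ⟨a, b, hb, rfl⟩ := S.exists_div z
    by_cases ha : a = 0
    · exact Or.inl ⟨a, b, hb, Or.inl ha, rfl⟩
    rcases le_total (elemOrd b) (elemOrd a) with hle | hle
    · exact Or.inl ⟨a, b, hb, Or.inr hle, rfl⟩
    · exact Or.inr ⟨b, a, ha, Or.inr hle, by rw [inv_div]⟩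

end Point

namespace IsParamPair

open Point

variable {K : Type*} [Field K] {S : Point K} {x y : S.ring}

theorem mem_orderVal_iff (h : IsParamPair x y) {z : K} :
    z ∈ S.orderVal ↔ ∃ A B : S.ring[X], S.red B ≠ 0 ∧
      z = S.ev ((y : K) / x) A / S.ev ((y : K) / x) B := h.mem_orderValuationRing_iff

theorem ev_mem_orderVal (h : IsParamPair x y) (A : S.ring[X]) :
    S.ev ((y : K) / x) A ∈ S.orderVal :=
  h.mem_orderVal_iff.2 ⟨A, 1, by simp, by simp⟩

theorem val_ev_eq_one (h : IsParamPair x y) {B : S.ring[X]} (hB : S.red B ≠ 0) :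
    S.orderVal.valuation (S.ev ((y : K) / x) B) = 1 := by
  refine le_antisymm ((S.orderVal.valuation_le_one_iff _).2 (h.ev_mem_orderVal B)) ?_
  have h1 : (S.ev ((y : K) / x) B)⁻¹ ∈ S.orderVal :=
    h.mem_orderVal_iff.2 ⟨1, B, hB, by simp⟩
  rw [← S.orderVal.valuation_le_one_iff, map_inv₀] at h1
  exact (inv_le_one₀ (by
    rw [zero_lt_iff, Valuation.ne_zero_iff]; exact h.ev_ne_zero hB)).1 h1

theorem val_left_lt_one (h : IsParamPair x y) : S.orderVal.valuation (x : K) < 1 := by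
  by_contra! hcon
  have h1 : (x : K)⁻¹ ∈ S.orderVal := by
    rw [← S.orderVal.valuation_le_one_iff, map_inv₀]
    exact inv_le_one_of_one_le₀ hcon
  obtain ⟨A, B, hB, hAB⟩ := h.mem_orderVal_iff.1 h1
  apply hB
  have hx := h.coe_ne_zero
  have h2 : S.ev ((y : K) / x) B = S.ev ((y : K) / x) 0 + x * S.ev ((y : K) / x) A := by
    have := h.ev_ne_zero hB
    field_simp at hAB
    rw [map_zero, zero_add, hAB]
  rw [h.red_eq_of_ev_eq_mul h2, map_zero]

theorem val_ev_lt_one_iff (h : IsParamPair x y) {A : S.ring[X]} :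
    S.orderVal.valuation (S.ev ((y : K) / x) A) < 1 ↔ S.red A = 0 := by
  constructor
  · intro hlt
    by_contra hA
    exact hlt.ne (h.val_ev_eq_one hA)
  · intro hA
    obtain ⟨B, hB⟩ := h.exists_ev_eq_mul hA
    rw [hB, map_mul]
    exact mul_lt_one_of_lt_of_le h.val_left_lt_one
      ((S.orderVal.valuation_le_one_iff _).2 (h.ev_mem_orderVal B))

/-- `x` is a uniformizer of the order valuation. -/
theorem exists_eq_mul_of_val_lt_one (h : IsParamPair x y) {A B : S.ring[X]} (hB : S.red B ≠ 0)
    (hz : S.orderVal.valuation (S.ev ((y : K) / x) A / S.ev ((y : K) / x) B) < 1) :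
    ∃ D, S.ev ((y : K) / x) A / S.ev ((y : K) / x) B
      = x * (S.ev ((y : K) / x) D / S.ev ((y : K) / x) B) := by
  rw [map_div₀, h.val_ev_eq_one hB, div_one, h.val_ev_lt_one_iff] at hz
  obtain ⟨D, hD⟩ := h.exists_ev_eq_mul hz
  exact ⟨D, by rw [hD, mul_div_assoc]⟩

theorem val_le_of_val_lt_one (h : IsParamPair x y) {z : K} (hz : S.orderVal.valuation z < 1) :
    S.orderVal.valuation z ≤ S.orderVal.valuation (x : K) := by
  obtain ⟨A, B, hB, rfl⟩ := h.mem_orderVal_iff.1 ((S.orderVal.valuation_le_one_iff z).1 hz.le)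
  obtain ⟨D, hD⟩ := h.exists_eq_mul_of_val_lt_one hB hz
  rw [hD, map_mul]
  exact mul_le_of_le_one_right' ((S.orderVal.valuation_le_one_iff _).2
    (h.mem_orderVal_iff.2 ⟨D, B, hB, rfl⟩))

end IsParamPair

/-! ### Infinitely near points -/

namespace Point

variable {K : Type*} [Field K] {S T : Point K}

theorem coe_incl (h : S ≤ T) (a : S.ring) : (incl h a : K) = a := rfl

theorem incl_injective (h : S ≤ T) : Function.Injective (incl h) := fun _ _ e =>
  Subtype.ext (congrArg (Subtype.val : T.ring → K) e)

theorem incl_ne_zero (h : S ≤ T) {a : S.ring} (ha : a ≠ 0) : incl h a ≠ 0 :=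
  (map_ne_zero_iff _ (incl_injective h)).2 ha

theorem exists_reduced_div (S : Point K) (z : K) :
    ∃ a b : S.ring, b ≠ 0 ∧ IsRelPrime a b ∧ z = (a : K) / (b : K) := by
  obtain ⟨a, b, hab, hz⟩ := IsFractionRing.exists_reduced_fraction (A := S.ring) z
  refine ⟨a, b, nonZeroDivisors.ne_zero b.2, hab, ?_⟩
  rw [← hz, IsFractionRing.mk'_eq_div]
  rfl

/-- Coprime non-units generate an ideal primary to the maximal ideal. -/
theorem eq_maximalIdeal_of_isRelPrime {a b : S.ring} (hab : IsRelPrime a b) {P : Ideal S.ring}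
    (hP : P.IsPrime) (ha : a ∈ P) (hb : b ∈ P) : P = maximalIdeal S.ring := by
  obtain ⟨x, y, h⟩ := S.exists_params
  by_contra hne
  obtain ⟨p, rfl⟩ := h.exists_eq_span hP hne
  rw [Ideal.mem_span_singleton] at ha hb
  exact hP.ne_top (Ideal.span_singleton_eq_top.2 (hab ha hb))

/-- An infinitely near point dominates: otherwise it would contain a discrete valuation ring of
the field. -/
theorem coe_mem_maxSet_iff (h : S ≤ T) {a : S.ring} :
    (a : K) ∈ T.maxSet ↔ a ∈ maximalIdeal S.ring := by
  constructor
  · intro ha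
    by_contra hu
    rw [mem_maximalIdeal, mem_nonunits_iff, not_not] at hu
    exact (coe_mem_maxSet (a := incl h a)).1 ha (hu.map (incl h))
  · have hP : ((maximalIdeal T.ring).comap (incl h)).IsPrime := Ideal.comap_isPrime _ _
    suffices hPm : (maximalIdeal T.ring).comap (incl h) = maximalIdeal S.ring by
      intro ha
      rw [← hPm] at ha
      exact coe_mem_maxSet.2 ha
    by_contra hne
    obtain ⟨z, hz, hz'⟩ := T.exists_notMem_inv_notMem
    obtain ⟨a, b, -, hab, rfl⟩ := S.exists_reduced_div z
    by_cases hb : (b : K) ∈ T.maxSet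
    · by_cases ha : (a : K) ∈ T.maxSet
      · exact hne (eq_maximalIdeal_of_isRelPrime hab hP (coe_mem_maxSet (a := incl h a).1 ha)
          (coe_mem_maxSet (a := incl h b).1 hb))
      · apply hz'
        rw [inv_div, div_eq_mul_inv]
        exact T.ring.mul_mem (h b.2) (inv_mem_of_notMem_maxSet (h a.2) ha)
    · apply hz
      rw [div_eq_mul_inv]
      exact T.ring.mul_mem (h a.2) (inv_mem_of_notMem_maxSet (h b.2) hb)

theorem isLocalHom_incl (h : S ≤ T) : IsLocalHom (incl h) := by
  refine ⟨fun a ha => ?_⟩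
  by_contra hu
  exact (coe_mem_maxSet (a := incl h a)).1
    ((coe_mem_maxSet_iff h).2 ((mem_maximalIdeal a).2 hu)) ha

theorem maxSet_subset (h : S ≤ T) : S.maxSet ⊆ T.maxSet := fun a ha =>
  (coe_mem_maxSet_iff h (a := ⟨a, ha.1⟩)).2 ha.2

theorem ext_of_le (h : S ≤ T) (h' : T ≤ S) : T = S :=
  Point.ext (le_antisymm h' h)

end Point

namespace IsParamPair

open Point

variable {K : Type*} [Field K] {S T : Point K} {x y : S.ring}

/-- If no curve of `T` is contracted to the closed point of `S`, then `T = S`: a reduced fraction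
over `S` is still reduced over `T`. -/
theorem eq_of_isRelPrime_incl (hp : IsParamPair x y) (h : S ≤ T)
    (hrel : IsRelPrime (incl h x) (incl h y)) : T = S := by
  refine ext_of_le h fun z hz => ?_
  obtain ⟨a, b, hb, hab, rfl⟩ := S.exists_reduced_div z
  have hba : incl h b ∣ incl h a :=
    ⟨⟨_, hz⟩, Subtype.ext (mul_div_cancel₀ _ (Point.coe_ne_zero.2 hb)).symm⟩
  have hu : IsUnit (incl h b) := by
    by_contra hu
    obtain ⟨q, hq, hqb⟩ := WfDvdMonoid.exists_irreducible_factor hu (incl_ne_zero h hb)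
    have hq' := hq.prime
    have hQ : (Ideal.span {q}).IsPrime := (Ideal.span_singleton_prime hq'.ne_zero).2 hq'
    have hQ' : ((Ideal.span {q}).comap (incl h)).IsPrime := Ideal.comap_isPrime _ _
    have hmem : ∀ {c : S.ring}, c ∈ (Ideal.span {q}).comap (incl h) ↔ q ∣ incl h c := by
      intro c
      rw [Ideal.mem_comap, Ideal.mem_span_singleton]
    have hm := eq_maximalIdeal_of_isRelPrime hab hQ' (hmem.2 (hqb.trans hba)) (hmem.2 hqb)
    exact hq.not_isUnit (hrel (hmem.1 (hm ▸ hp.left_mem)) (hmem.1 (hm ▸ hp.right_mem)))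
  have hu' : IsUnit b := (isLocalHom_incl h).map_nonunit b hu
  rw [div_eq_mul_inv]
  exact S.ring.mul_mem a.2 (inv_mem_of_notMem_maxSet b.2 (isUnit_iff_notMem_maxSet.1 hu'))

/-- If `y / x` is a quotient of coprime non-units of `T ⊇ S`, then the order valuation of `S` is
less than one on the maximal ideal of `T`, because the residue class of `y / x` is
transcendental over the residue field of `T`. -/
theorem val_lt_one_of_mem_maxSet (hp : IsParamPair x y) (h : S ≤ T) {a b : T.ring}
    (ha : a ∈ maximalIdeal T.ring) (hb : b ∈ maximalIdeal T.ring) (hb0 : b ≠ 0)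
    (hab : IsRelPrime b a) (he : (y : K) / x = (a : K) / b) {z : K} (hz : z ∈ T.maxSet) :
    S.orderVal.valuation z < 1 := by
  by_contra! hcon
  have h1 : z⁻¹ ∈ S.orderVal := by
    rw [← S.orderVal.valuation_le_one_iff, map_inv₀]
    exact inv_le_one_of_one_le₀ hcon
  obtain ⟨A, B, hB, hAB⟩ := hp.mem_orderVal_iff.1 h1
  have hz0 : z ≠ 0 := by
    rintro rfl
    rw [map_zero] at hcon
    exact absurd hcon (not_le.2 zero_lt_one)
  have hev : ∀ D : S.ring[X], T.ev ((a : K) / b) (D.map (incl h)) = S.ev ((y : K) / x) D := by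
    intro D
    rw [he]
    change eval₂ _ _ (D.map _) = eval₂ _ _ D
    rw [eval₂_map]
    rfl
  have hzero : T.ev ((a : K) / b) (C ⟨z, hz.1⟩ * A.map (incl h) - B.map (incl h)) = 0 := by
    rw [map_sub, map_mul, ev_C, hev, hev]
    have := hp.ev_ne_zero hB
    field_simp at hAB
    rw [sub_eq_zero, hAB]
  have hred := red_eq_zero_iff.1 (red_eq_zero_of_ev_eq_zero hb ha hb0 hab hzero)
  refine hB (red_eq_zero_iff.2 fun i => ?_)
  have h2 := hred i
  rw [coeff_sub, coeff_C_mul, coeff_map, coeff_map] at h2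
  have h3 : incl h (B.coeff i) ∈ maximalIdeal T.ring := by
    have := Ideal.sub_mem _ (Ideal.mul_mem_right (incl h (A.coeff i)) _ hz.2) h2
    rwa [sub_sub_cancel] at this
  exact (coe_mem_maxSet_iff h).1 (coe_mem_maxSet.2 h3)

/-- A point properly containing `S` contains one of the two affine charts of the blow-up of the
closed point of `S`. -/
theorem div_mem_or_div_mem (hp : IsParamPair x y) (h : S ≤ T) (hne : T ≠ S) :
    (y : K) / x ∈ T.ring ∨ (x : K) / y ∈ T.ring := by
  by_contra! hcon
  obtain ⟨h1, h2⟩ := hcon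
  have hx := hp.coe_ne_zero
  have hy := hp.symm.coe_ne_zero
  obtain ⟨a, b, hb0, hab, he⟩ := T.exists_reduced_div ((y : K) / x)
  have hb0' : (b : K) ≠ 0 := Point.coe_ne_zero.2 hb0
  have ha0' : (a : K) ≠ 0 := by
    intro ha
    rw [ha, zero_div, div_eq_zero_iff] at he
    tauto
  have hb : b ∈ maximalIdeal T.ring := by
    rw [← coe_mem_maxSet]
    by_contra hb
    apply h1
    rw [he, div_eq_mul_inv]
    exact T.ring.mul_mem a.2 (inv_mem_of_notMem_maxSet b.2 hb)
  have ha : a ∈ maximalIdeal T.ring := by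
    rw [← coe_mem_maxSet]
    by_contra ha
    apply h2
    rw [← inv_div, he, inv_div, div_eq_mul_inv]
    exact T.ring.mul_mem b.2 (inv_mem_of_notMem_maxSet a.2 ha)
  have hcross : incl h x * a = incl h y * b := by
    apply Subtype.ext
    rw [Subring.coe_mul, Subring.coe_mul, coe_incl, coe_incl]
    field_simp at he
    linear_combination -he
  obtain ⟨d, hd⟩ : b ∣ incl h x :=
    hab.symm.dvd_of_dvd_mul_right (hcross ▸ Dvd.intro_left _ rfl)
  have hd' : incl h y = a * d := by
    apply mul_right_cancel₀ hb0
    rw [← hcross, hd]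
    ring
  have hval := fun {z : K} (hz : z ∈ T.maxSet) =>
    hp.val_lt_one_of_mem_maxSet h ha hb hb0 hab.symm he hz
  have hdu : IsUnit d := by
    rw [isUnit_iff_notMem_maxSet]
    intro hdm
    have hle := hp.val_le_of_val_lt_one (hval hdm)
    have hbv := hval (coe_mem_maxSet.2 hb)
    have hxv : S.orderVal.valuation (x : K)
        = S.orderVal.valuation (b : K) * S.orderVal.valuation (d : K) := by
      rw [← map_mul, ← Subring.coe_mul, ← hd, coe_incl]
    have hx0 : 0 < S.orderVal.valuation (x : K) := by
      rw [zero_lt_iff, Valuation.ne_zero_iff]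
      exact hx
    have : S.orderVal.valuation (x : K) < S.orderVal.valuation (x : K) := by
      calc S.orderVal.valuation (x : K)
          ≤ S.orderVal.valuation (b : K) * S.orderVal.valuation (x : K) := by
            conv_lhs => rw [hxv]
            gcongr
        _ < S.orderVal.valuation (x : K) := mul_lt_of_lt_one_left hx0 hbv
    exact lt_irrefl _ this
  refine hne (hp.eq_of_isRelPrime_incl h ?_)
  intro q hq1 hq2
  rw [hd, hdu.dvd_mul_right] at hq1
  rw [hd', hdu.dvd_mul_right] at hq2
  exact hab hq2 hq1

end IsParamPair

/-! ### Blowing up a point -/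

theorem isFractionRing_of_le {K : Type*} [Field K] {A B : Subring K} [IsFractionRing A K]
    (h : A ≤ B) : IsFractionRing B K := by
  rw [IsFractionRing, isLocalization_iff]
  refine ⟨fun b => ?_, fun z => ?_, fun {a b} e => ⟨1, ?_⟩⟩
  · rw [isUnit_iff_ne_zero]
    intro h0
    exact nonZeroDivisors.ne_zero b.2 (Subtype.ext h0)
  · obtain ⟨a, b, hb, rfl⟩ := IsFractionRing.div_surjective (A := A) z
    have hb0 : (b : K) ≠ 0 := fun h0 => nonZeroDivisors.ne_zero hb (Subtype.ext h0)
    refine ⟨⟨⟨a, h a.2⟩, ⟨⟨b, h b.2⟩, mem_nonZeroDivisors_of_ne_zero fun h0 =>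
      hb0 (congrArg Subtype.val h0)⟩⟩, ?_⟩
    exact div_mul_cancel₀ (a : K) hb0
  · rw [Subtype.ext e]

namespace IsParamPair

open Point

variable {K : Type*} [Field K] {S T : Point K} {x y : S.ring}

theorem red_ne_zero {F B : S.ring[X]} (hB : ¬ S.red F ∣ S.red B) : S.red B ≠ 0 :=
  fun h0 => hB (h0 ▸ dvd_zero _)

/-- The local ring, on the blow-up of the closed point of `S`, of the point of the exceptional
line with affine coordinate `t = y / x` at which the irreducible polynomial `F` over the residue
field vanishes: it consists of the quotients `A(t) / B(t)` such that `F` does not divide `B` modulo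
the maximal ideal. -/
def blowupRing (hp : IsParamPair x y) {F : S.ring[X]} (hF : Irreducible (S.red F)) :
    Subring K where
  carrier := {z | ∃ A B : S.ring[X], ¬ S.red F ∣ S.red B ∧
    z = S.ev ((y : K) / x) A / S.ev ((y : K) / x) B}
  one_mem' := ⟨1, 1, by rw [map_one]; exact hF.prime.not_dvd_one, by simp⟩
  zero_mem' := ⟨0, 1, by rw [map_one]; exact hF.prime.not_dvd_one, by simp⟩
  neg_mem' := by
    rintro _ ⟨A, B, hB, rfl⟩
    exact ⟨-A, B, hB, by rw [map_neg, neg_div]⟩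
  add_mem' := by
    rintro _ _ ⟨A, B, hB, rfl⟩ ⟨C, D, hD, rfl⟩
    refine ⟨A * D + B * C, B * D, ?_, ?_⟩
    · rw [map_mul]
      exact fun h => (hF.prime.dvd_or_dvd h).elim hB hD
    · simp only [map_add, map_mul]
      exact div_add_div _ _ (hp.ev_ne_zero (red_ne_zero hB)) (hp.ev_ne_zero (red_ne_zero hD))
  mul_mem' := by
    rintro _ _ ⟨A, B, hB, rfl⟩ ⟨C, D, hD, rfl⟩
    refine ⟨A * C, B * D, ?_, ?_⟩
    · rw [map_mul]
      exact fun h => (hF.prime.dvd_or_dvd h).elim hB hD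
    · simp only [map_mul]
      exact div_mul_div_comm _ _ _ _

variable (hp : IsParamPair x y) {F : S.ring[X]} (hF : Irreducible (S.red F))

include hp hF

theorem ev_mem_blowupRing (A : S.ring[X]) : S.ev ((y : K) / x) A ∈ hp.blowupRing hF :=
  ⟨A, 1, by rw [map_one]; exact hF.prime.not_dvd_one, by simp⟩

theorem coe_mem_blowupRing (a : S.ring) : (a : K) ∈ hp.blowupRing hF := by
  rw [← S.ev_C ((y : K) / x) a]
  exact hp.ev_mem_blowupRing hF _

theorem isUnit_blowupRing_iff {A B : S.ring[X]} (hB : ¬ S.red F ∣ S.red B)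
    {z : hp.blowupRing hF} (hz : (z : K) = S.ev ((y : K) / x) A / S.ev ((y : K) / x) B) :
    IsUnit z ↔ ¬ S.red F ∣ S.red A := by
  constructor
  · intro hu hA
    obtain ⟨⟨w, C, D, hD, rfl⟩, hw⟩ := hu.exists_right_inv
    have hw' := congrArg (Subtype.val : hp.blowupRing hF → K) hw
    rw [Subring.coe_mul, hz, Subring.coe_one, div_mul_div_comm,
      div_eq_one_iff_eq (mul_ne_zero (hp.ev_ne_zero (red_ne_zero hB))
        (hp.ev_ne_zero (red_ne_zero hD))), ← map_mul, ← map_mul] at hw'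
    have hr := hp.red_eq_of_ev_eq hw'
    rw [map_mul, map_mul] at hr
    exact (hF.prime.dvd_or_dvd (hr ▸ hA.mul_right _)).elim hB hD
  · intro hA
    have hA0 := hp.ev_ne_zero (red_ne_zero hA)
    have hB0 := hp.ev_ne_zero (red_ne_zero hB)
    refine .of_mul_eq_one ⟨_, B, A, hA, rfl⟩ (Subtype.ext ?_)
    rw [Subring.coe_mul, hz, Subring.coe_one]
    field_simp

theorem isLocalRing_blowupRing : IsLocalRing (hp.blowupRing hF) := by
  refine IsLocalRing.of_isUnit_or_isUnit_one_sub_self ?_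
  rintro ⟨z, A, B, hB, rfl⟩
  rw [hp.isUnit_blowupRing_iff hF hB rfl]
  have hB0 := hp.ev_ne_zero (red_ne_zero hB)
  rw [hp.isUnit_blowupRing_iff hF (A := B - A) hB (by
    rw [AddSubgroupClass.coe_sub, Subring.coe_one, map_sub]
    field_simp)]
  by_contra! hcon
  apply hB
  have := dvd_add hcon.1 hcon.2
  rwa [← map_add, add_sub_cancel] at this

theorem isNoetherianRing_blowupRing : IsNoetherianRing (hp.blowupRing hF) := by
  rw [isNoetherianRing_iff_ideal_fg]
  intro I
  let φ : S.ring[X] →+* hp.blowupRing hF :=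
    (S.ev ((y : K) / x)).codRestrict _ (hp.ev_mem_blowupRing hF)
  have hI : I = (I.comap φ).map φ := by
    refine le_antisymm ?_ Ideal.map_comap_le
    rintro ⟨z, A, B, hB, rfl⟩ hz
    have hB0 := hp.ev_ne_zero (red_ne_zero hB)
    have hu : IsUnit (φ B) :=
      (hp.isUnit_blowupRing_iff hF (A := B) (B := 1)
        (by rw [map_one]; exact hF.prime.not_dvd_one) (by simp [φ])).2 hB
    have he : φ A = φ B * ⟨_, A, B, hB, rfl⟩ := by
      apply Subtype.ext
      change S.ev _ A = S.ev _ B * (S.ev _ A / S.ev _ B)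
      field_simp
    have hA : A ∈ I.comap φ := by
      rw [Ideal.mem_comap, he]
      exact I.mul_mem_left _ hz
    have hA' := Ideal.mem_map_of_mem φ hA
    rw [he] at hA'
    exact (Ideal.unit_mul_mem_iff_mem _ hu).1 hA'
  rw [hI]
  exact Ideal.FG.map (IsNoetherian.noetherian (I.comap φ)) φ

theorem blowupRing_le_orderVal {z : K} (hz : z ∈ hp.blowupRing hF) : z ∈ S.orderVal := by
  obtain ⟨A, B, hB, rfl⟩ := hz
  exact hp.mem_orderVal_iff.2 ⟨A, B, red_ne_zero hB, rfl⟩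

theorem dvd_iff_val_lt_one {z : hp.blowupRing hF} :
    (⟨x, hp.coe_mem_blowupRing hF x⟩ : hp.blowupRing hF) ∣ z ↔
      S.orderVal.valuation (z : K) < 1 := by
  constructor
  · rintro ⟨w, rfl⟩
    rw [Subring.coe_mul, map_mul]
    exact mul_lt_one_of_lt_of_le hp.val_left_lt_one
      ((S.orderVal.valuation_le_one_iff _).2 (hp.blowupRing_le_orderVal hF w.2))
  · intro hz
    obtain ⟨z, A, B, hB, rfl⟩ := z
    obtain ⟨D, hD⟩ := hp.exists_eq_mul_of_val_lt_one (red_ne_zero hB) hz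
    exact ⟨⟨_, D, B, hB, rfl⟩, Subtype.ext hD⟩

theorem regular_blowupRing : IsRegularLocalRing (hp.blowupRing hF) ∧
    ∃ _ : IsLocalRing (hp.blowupRing hF), ∃ _ : IsNoetherianRing (hp.blowupRing hF),
    IsParamPair (⟨x, hp.coe_mem_blowupRing hF x⟩ : hp.blowupRing hF)
      ⟨S.ev ((y : K) / x) F, hp.ev_mem_blowupRing hF F⟩ := by
  have hloc := hp.isLocalRing_blowupRing hF
  have hnoeth := hp.isNoetherianRing_blowupRing hF
  have h1 : ¬ S.red F ∣ S.red 1 := by rw [map_one]; exact hF.prime.not_dvd_one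
  have hx := hp.coe_ne_zero
  have hxm : (⟨x, hp.coe_mem_blowupRing hF x⟩ : hp.blowupRing hF) ∈
      maximalIdeal (hp.blowupRing hF) := by
    rw [mem_maximalIdeal, mem_nonunits_iff, hp.isUnit_blowupRing_iff hF (A := C x) h1
      (by simp [ev_C]), not_not, red_C, (residue_eq_zero_iff _).2 hp.left_mem, map_zero]
    exact dvd_zero _
  have hprime : Prime (⟨x, hp.coe_mem_blowupRing hF x⟩ : hp.blowupRing hF) := by
    refine ⟨fun h0 => hx (congrArg Subtype.val h0), hxm, fun a b hab => ?_⟩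
    rw [hp.dvd_iff_val_lt_one hF, Subring.coe_mul, map_mul] at hab
    rw [hp.dvd_iff_val_lt_one hF, hp.dvd_iff_val_lt_one hF]
    by_contra! hcon
    have := one_le_mul hcon.1 hcon.2
    exact absurd hab (not_lt.2 this)
  refine ⟨(isParamPair_of_prime (y := ⟨_, hp.ev_mem_blowupRing hF F⟩) ?_ hprime ?_).1,
    hloc, hnoeth, (isParamPair_of_prime ?_ hprime ?_).2⟩
  all_goals first
    | rw [hp.dvd_iff_val_lt_one hF, hp.val_ev_lt_one_iff]
      exact hF.ne_zero
    | skip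
  all_goals
    apply le_antisymm
    · rintro ⟨z, A, B, hB, rfl⟩ hz
      rw [mem_maximalIdeal, mem_nonunits_iff, hp.isUnit_blowupRing_iff hF hB rfl, not_not] at hz
      obtain ⟨Q, hQ⟩ := hz
      obtain ⟨Q, rfl⟩ := S.red_surjective Q
      rw [← map_mul, ← sub_eq_zero, ← map_sub] at hQ
      obtain ⟨D, hD⟩ := hp.exists_ev_eq_mul hQ
      rw [map_sub, map_mul] at hD
      rw [Ideal.mem_span_pair]
      refine ⟨⟨_, D, B, hB, rfl⟩, ⟨_, Q, B, hB, rfl⟩, Subtype.ext ?_⟩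
      have hB0 := hp.ev_ne_zero (red_ne_zero hB)
      rw [Subring.coe_add, Subring.coe_mul, Subring.coe_mul]
      field_simp
      linear_combination -hD
    · rw [Ideal.span_le]
      rintro z (rfl | rfl)
      · exact hxm
      · change _ ∈ maximalIdeal _
        rw [mem_maximalIdeal, mem_nonunits_iff, hp.isUnit_blowupRing_iff hF (A := F) h1
          (by simp), not_not]

/-- The point with ring `blowupRing`. -/
def blowup : Point K where
  ring := hp.blowupRing hF
  regular := (hp.regular_blowupRing hF).1
  dim_eq_two := by
    obtain ⟨_, _, _, h⟩ := hp.regular_blowupRing hF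
    exact h.dim_eq
  isFractionRing := isFractionRing_of_le (A := S.ring) fun a ha => hp.coe_mem_blowupRing hF ⟨a, ha⟩

theorem le_blowup : S ≤ hp.blowup hF := fun a ha => hp.coe_mem_blowupRing hF ⟨a, ha⟩

theorem ev_mem_blowup (A : S.ring[X]) : S.ev ((y : K) / x) A ∈ (hp.blowup hF).ring :=
  hp.ev_mem_blowupRing hF A

theorem blowup_params : IsParamPair (incl (hp.le_blowup hF) x)
    (⟨S.ev ((y : K) / x) F, hp.ev_mem_blowup hF F⟩ : (hp.blowup hF).ring) := by
  obtain ⟨_, _, _, h⟩ := hp.regular_blowupRing hF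
  exact h

theorem ev_div_mem_maxSet_blowup_iff {A B : S.ring[X]} (hB : ¬ S.red F ∣ S.red B) :
    S.ev ((y : K) / x) A / S.ev ((y : K) / x) B ∈ (hp.blowup hF).maxSet ↔
      S.red F ∣ S.red A := by
  have := hp.isUnit_blowupRing_iff hF (A := A) hB (z := ⟨_, A, B, hB, rfl⟩) rfl
  rw [← not_iff_not, ← this]
  exact (isUnit_iff_notMem_maxSet (S := hp.blowup hF) (a := ⟨_, A, B, hB, rfl⟩)).symm

theorem ev_mem_maxSet_blowup_iff {A : S.ring[X]} :
    S.ev ((y : K) / x) A ∈ (hp.blowup hF).maxSet ↔ S.red F ∣ S.red A := by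
  have := hp.ev_div_mem_maxSet_blowup_iff hF (A := A) (B := 1)
    (by rw [map_one]; exact hF.prime.not_dvd_one)
  rwa [map_one, div_one] at this

theorem blowup_le_orderVal {z : K} (hz : z ∈ (hp.blowup hF).ring) : z ∈ S.orderVal :=
  hp.blowupRing_le_orderVal hF hz

/-- In the blow-up, the exceptional line is the centre of the order valuation. -/
theorem incl_dvd_iff {z : (hp.blowup hF).ring} :
    incl (hp.le_blowup hF) x ∣ z ↔ S.orderVal.valuation (z : K) < 1 :=
  hp.dvd_iff_val_lt_one hF

/-- Universal property of the points of the blow-up. -/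
theorem blowup_le (h : S ≤ T) (ht : (y : K) / x ∈ T.ring)
    (hm : S.ev ((y : K) / x) F ∈ T.maxSet) : hp.blowup hF ≤ T := by
  rintro z ⟨A, B, hB, rfl⟩
  rw [div_eq_mul_inv]
  refine T.ring.mul_mem (ev_mem h ht A) (inv_mem_of_notMem_maxSet (ev_mem h ht B) fun hBm => ?_)
  obtain ⟨P, Q, hPQ⟩ := (hF.coprime_iff_not_dvd).2 hB
  obtain ⟨P, rfl⟩ := S.red_surjective P
  obtain ⟨Q, rfl⟩ := S.red_surjective Q
  rw [← map_mul, ← map_mul, ← map_add, ← map_one S.red, ← sub_eq_zero, ← map_sub] at hPQ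
  obtain ⟨D, hD⟩ := hp.exists_ev_eq_mul hPQ
  have hxm : (x : K) ∈ T.maxSet := (coe_mem_maxSet_iff h).2 hp.left_mem
  have e : (1 : K) = S.ev ((y : K) / x) P * S.ev ((y : K) / x) F
      + S.ev ((y : K) / x) Q * S.ev ((y : K) / x) B - S.ev ((y : K) / x) D * x := by
    simp only [map_sub, map_add, map_mul, map_one] at hD
    linear_combination -hD
  apply one_notMem_maxSet (S := T)
  rw [e]
  exact sub_mem_maxSet (add_mem_maxSet (mul_mem_maxSet (ev_mem h ht P) hm)
    (mul_mem_maxSet (ev_mem h ht Q) hBm)) (mul_mem_maxSet (ev_mem h ht D) hxm)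

/-- The residue field of a point of the blow-up is generated by the residue class of the affine
coordinate. -/
theorem exists_sub_ev_mem_maxSet {z : K} (hz : z ∈ (hp.blowup hF).ring) :
    ∃ A : S.ring[X], z - S.ev ((y : K) / x) A ∈ (hp.blowup hF).maxSet := by
  obtain ⟨A, B, hB, rfl⟩ := hz
  obtain ⟨P, Q, hPQ⟩ := (hF.coprime_iff_not_dvd).2 hB
  obtain ⟨Q, rfl⟩ := S.red_surjective Q
  refine ⟨Q * A, ?_⟩
  have hB0 := hp.ev_ne_zero (red_ne_zero hB)
  have e : S.ev ((y : K) / x) A / S.ev ((y : K) / x) B - S.ev ((y : K) / x) (Q * A)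
      = S.ev ((y : K) / x) (A - Q * A * B) / S.ev ((y : K) / x) B := by
    simp only [map_sub, map_mul]
    field_simp
  rw [e, hp.ev_div_mem_maxSet_blowup_iff hF hB]
  refine ⟨P * S.red A, ?_⟩
  simp only [map_sub, map_mul]
  linear_combination (-S.red A) * hPQ

theorem blowup_ne : hp.blowup hF ≠ S := by
  intro he
  have hm : (y : K) / x ∈ (hp.blowup hF).ring := by
    rw [← S.ev_X ((y : K) / x)]
    exact hp.ev_mem_blowup hF X
  rw [he] at hm
  exact hp.not_dvd ⟨⟨_, hm⟩, Subtype.ext (mul_div_cancel₀ _ hp.coe_ne_zero).symm⟩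

end IsParamPair

namespace Point

variable {K : Type*} [Field K] {R S T : Point K}

/-! ### Strict transforms of curves -/

theorem height_maximalIdeal (S : Point K) : (maximalIdeal S.ring).height = 2 := by
  obtain ⟨x, y, h⟩ := S.exists_params
  exact h.height_eq

/-- A non-maximal prime ideal of a point has height at most one. -/
theorem one_lt_height_iff {P : Ideal S.ring} (hP : P.IsPrime) :
    1 < P.height ↔ P = maximalIdeal S.ring := by
  constructor
  · intro hlt
    by_contra hne
    have h1 := Ideal.height_add_one_le_of_lt_of_isPrime
      (lt_of_le_of_ne (le_maximalIdeal hP.ne_top) hne)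
    rw [height_maximalIdeal, ← one_add_one_eq_two] at h1
    exact absurd hlt (not_lt.2 ((ENat.add_le_add_iff_right (by decide)).1 h1))
  · rintro rfl
    rw [height_maximalIdeal]
    decide

/-- A prime is exceptional if and only if it divides the whole maximal ideal of the base point. -/
theorem isExceptionalPrime_iff (h : R ≤ S) {q : S.ring} (hq : Prime q) :
    IsExceptionalPrime (incl h) q ↔ ∀ a ∈ maximalIdeal R.ring, q ∣ incl h a := by
  have hQ : (Ideal.span {q}).IsPrime := (Ideal.span_singleton_prime hq.ne_zero).2 hq
  have hP : ((Ideal.span {q}).comap (incl h)).IsPrime := Ideal.comap_isPrime _ _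
  have hmem : ∀ {c : R.ring}, c ∈ (Ideal.span {q}).comap (incl h) ↔ q ∣ incl h c := by
    intro c
    rw [Ideal.mem_comap, Ideal.mem_span_singleton]
  rw [IsExceptionalPrime, and_iff_right hq, one_lt_height_iff hP]
  constructor
  · intro he a ha
    rwa [← hmem, he]
  · intro hd
    refine le_antisymm (le_maximalIdeal hP.ne_top) fun a ha => hmem.2 (hd a ha)

/-- `gS` is the strict transform in `S` of the curve `fR`: up to exceptional prime factors `f` is
equal to `g`, and `g` has no exceptional prime factor. -/
def IsStrict (h : R ≤ S) (f : R.ring) (g : S.ring) : Prop :=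
  g ≠ 0 ∧ ∃ c : S.ring, c ≠ 0 ∧ incl h f = c * g ∧
    (∀ q, Prime q → q ∣ c → IsExceptionalPrime (incl h) q) ∧
    (∀ q, Prime q → q ∣ g → ¬ IsExceptionalPrime (incl h) q)

theorem exists_isStrict (h : R ≤ S) {f : R.ring} (hf : f ≠ 0) : ∃ g, IsStrict h f g := by
  have hf' := incl_ne_zero h hf
  obtain ⟨c, g, hcg, hc, hg⟩ := exists_eq_mul_prime_split hf' (IsExceptionalPrime (incl h))
  have h0 := mul_ne_zero_iff.1 (hcg ▸ hf')
  refine ⟨g, h0.2, c, h0.1, hcg, fun q hq hd => ?_, fun q hq hd => ?_⟩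
  · obtain ⟨q', hqq', he⟩ := hc q hq hd
    rw [isExceptionalPrime_iff h hq]
    exact fun a ha => hqq'.dvd.trans ((isExceptionalPrime_iff h (hqq'.prime hq)).1 he a ha)
  · obtain ⟨q', hqq', he⟩ := hg q hq hd
    rw [isExceptionalPrime_iff h hq]
    refine fun hcon => he ((isExceptionalPrime_iff h (hqq'.prime hq)).2 fun a ha => ?_)
    exact hqq'.symm.dvd.trans (hcon a ha)

theorem IsStrict.strict_eq {h : R ≤ S} {f : R.ring} {g : S.ring} (hs : IsStrict h f g) :
    strict h (Ideal.span {f}) = Ideal.span {g} := by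
  obtain ⟨-, c, hc0, hf, hc, hg⟩ := hs
  exact strictTransform_eq_span hc0 hf hc hg

theorem IsStrict.idealOrd_eq {h : R ≤ S} {f : R.ring} {g : S.ring} (hs : IsStrict h f g) :
    idealOrd (strict h (Ideal.span {f})) = elemOrd g := by
  rw [hs.strict_eq, idealOrd_span_singleton hs.1]

/-- Strict transforms are transitive. -/
theorem IsStrict.trans {h : R ≤ S} {h' : S ≤ T} {f : R.ring} {g : S.ring} {e : T.ring}
    (hs : IsStrict h f g) (hs' : IsStrict h' g e) : IsStrict (le_trans' h h') f e := by
  obtain ⟨hg0, c, hc0, hf, hc, hg⟩ := hs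
  obtain ⟨he0, d, hd0, hge, hd, he⟩ := hs'
  refine ⟨he0, incl h' c * d, mul_ne_zero (incl_ne_zero h' hc0) hd0, ?_, ?_, ?_⟩
  · have : incl (le_trans' h h') f = incl h' (incl h f) := rfl
    rw [this, hf, map_mul, hge, mul_assoc]
  · intro q hq hqcd
    rw [isExceptionalPrime_iff _ hq]
    intro a ha
    have ha' : incl h a ∈ maximalIdeal S.ring :=
      coe_mem_maxSet.1 ((coe_mem_maxSet_iff h).2 ha)
    rcases hq.dvd_or_dvd hqcd with hqc | hqd
    · -- a prime factor of `c` below `q` is exceptional over `R`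
      have hQ : (Ideal.span {q}).IsPrime := (Ideal.span_singleton_prime hq.ne_zero).2 hq
      have hP : ((Ideal.span {q}).comap (incl h')).IsPrime := Ideal.comap_isPrime _ _
      have hcP : c ∈ (Ideal.span {q}).comap (incl h') := by
        rwa [Ideal.mem_comap, Ideal.mem_span_singleton]
      obtain ⟨p, hp, hpP, hpc⟩ : ∃ p, Prime p ∧ p ∈ (Ideal.span {q}).comap (incl h') ∧ p ∣ c := by
        obtain ⟨s, hs, u, hu⟩ := UniqueFactorizationMonoid.exists_prime_factors c hc0
        rw [← hu, hP.mul_mem_iff_mem_or_mem] at hcP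
        have hsP := hcP.resolve_right fun hm => hP.ne_top (Ideal.eq_top_of_isUnit_mem _ hm u.isUnit)
        obtain ⟨p, hps, hpP⟩ := (hP.multiset_prod_mem_iff_exists_mem s).1 hsP
        exact ⟨p, hs p hps, hpP, (Multiset.dvd_prod hps).trans ⟨u, hu.symm⟩⟩
      have h1 := (isExceptionalPrime_iff h hp).1 (hc p hp hpc) a ha
      rw [Ideal.mem_comap, Ideal.mem_span_singleton] at hpP
      exact hpP.trans (map_dvd (incl h') h1)
    · exact (isExceptionalPrime_iff h' hq).1 (hd q hq hqd) _ ha'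
  · intro q hq hqe hexc
    rw [isExceptionalPrime_iff _ hq] at hexc
    have hnot := he q hq hqe
    have hQ : (Ideal.span {q}).IsPrime := (Ideal.span_singleton_prime hq.ne_zero).2 hq
    have hP : ((Ideal.span {q}).comap (incl h')).IsPrime := Ideal.comap_isPrime _ _
    have hne : (Ideal.span {q}).comap (incl h') ≠ maximalIdeal S.ring := fun hm =>
      hnot ⟨hq, (one_lt_height_iff hP).2 hm⟩
    obtain ⟨x, y, hxy⟩ := S.exists_params
    obtain ⟨p, hp⟩ := hxy.exists_eq_span hP hne
    have hmem : ∀ {b : S.ring}, q ∣ incl h' b ↔ p ∣ b := by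
      intro b
      rw [← Ideal.mem_span_singleton (x := b), ← hp, Ideal.mem_comap, Ideal.mem_span_singleton]
    have hpg : p ∣ g := by
      rw [← hmem, hge]
      exact hqe.mul_left d
    have hp0 : p ≠ 0 := fun h0 => hg0 (zero_dvd_iff.1 (h0 ▸ hpg))
    have hpp : Prime p := by rwa [← Ideal.span_singleton_prime hp0, ← hp]
    exact hg p hpp hpg ((isExceptionalPrime_iff h hpp).2 fun a ha => hmem.1 (hexc a ha))

/-- A curve that does not pass through `S` does not pass through the points over `S`. -/
theorem IsStrict.strict_eq_top {h : R ≤ S} {f : R.ring} {g : S.ring} (hs : IsStrict h f g)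
    (hg : IsUnit g) (h' : S ≤ T) : strict (le_trans' h h') (Ideal.span {f}) = ⊤ := by
  obtain ⟨e, he⟩ := exists_isStrict h' hs.1
  rw [(hs.trans he).strict_eq, Ideal.span_singleton_eq_top]
  obtain ⟨-, c, -, hc, -⟩ := he
  exact isUnit_of_mul_isUnit_right (hc ▸ hg.map (incl h'))

/-- In the blow-up, the strict transform of a curve of order `n` is obtained by dividing out the
`n`-th power of the exceptional line. -/
theorem isStrict_blowup {x y : S.ring} (hp : IsParamPair x y) {F : S.ring[X]}
    (hF : Irreducible (S.red F)) {f : S.ring} {n : ℕ} {A : S.ring[X]} (hA : S.red A ≠ 0)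
    (hf : (f : K) = (x : K) ^ n * S.ev ((y : K) / x) A) :
    IsStrict (hp.le_blowup hF) f ⟨_, hp.ev_mem_blowup hF A⟩ := by
  have hx := (hp.blowup_params hF).prime
  refine ⟨fun h0 => hp.ev_ne_zero hA (congrArg Subtype.val h0),
    incl (hp.le_blowup hF) x ^ n, pow_ne_zero _ hx.ne_zero, Subtype.ext ?_,
    fun q hq hd => ?_, fun q hq hd hexc => ?_⟩
  · rw [Subring.coe_mul, Subring.coe_pow]
    exact hf
  · rw [isExceptionalPrime_iff _ hq]
    intro a ha
    obtain ⟨b, c, rfl⟩ := hp.mem_max_iff.1 ha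
    refine (hq.dvd_of_dvd_pow hd).trans ?_
    rw [map_add, map_mul, map_mul]
    refine dvd_add (Dvd.intro_left _ rfl) (Dvd.dvd.mul_left ?_ _)
    refine ⟨⟨_, hp.ev_mem_blowup hF X⟩, Subtype.ext ?_⟩
    change (y : K) = x * S.ev ((y : K) / x) X
    rw [ev_X, mul_div_cancel₀ _ hp.coe_ne_zero]
  · have hqx := (isExceptionalPrime_iff _ hq).1 hexc x hp.left_mem
    have hxA := (hq.associated_of_dvd hx hqx).symm.dvd.trans hd
    rw [hp.incl_dvd_iff hF, hp.val_ev_lt_one_iff] at hxA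
    exact hA hxA

/-! ### Residue degrees -/

/-- If the residue field of `T` is generated over that of `S` by the residue class of `t`, a zero of
the irreducible polynomial `F`, then the residue degree is the degree of `F`. -/
theorem degree_eq_natDegree (h : S ≤ T) {t : K} (ht : t ∈ T.ring) {F : S.ring[X]}
    (hF : Irreducible (S.red F)) (hm : S.ev t F ∈ T.maxSet)
    (hgen : ∀ z ∈ T.ring, ∃ A : S.ring[X], z - S.ev t A ∈ T.maxSet) :
    degree h = (S.red F).natDegree := by
  have hl := isLocalHom_incl h
  rw [degree, dif_pos hl]
  let _ : Algebra (ResidueField S.ring) (ResidueField T.ring) :=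
    (ResidueField.map (incl h)).toAlgebra
  change Module.finrank (ResidueField S.ring) (ResidueField T.ring) = _
  let τ : ResidueField T.ring := residue T.ring ⟨t, ht⟩
  have haeval : ∀ A : S.ring[X], aeval τ (S.red A) = residue T.ring ⟨_, ev_mem h ht A⟩ := by
    intro A
    have e1 : (⟨_, ev_mem h ht A⟩ : T.ring) = eval₂ (incl h) ⟨t, ht⟩ A := by
      apply Subtype.ext
      change _ = T.ring.subtype _
      rw [hom_eval₂]
      rfl
    rw [e1, hom_eval₂, aeval_def]
    change eval₂ _ _ (A.map _) = _
    rw [eval₂_map]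
    rfl
  have hroot : aeval τ (S.red F) = 0 := by
    rw [haeval, residue_eq_zero_iff]
    exact hm.2
  have hmin := minpoly.eq_of_irreducible hF hroot
  have hint : IsIntegral (ResidueField S.ring) τ :=
    isAlgebraic_iff_isIntegral.1 ⟨_, hF.ne_zero, hroot⟩
  have htop : IntermediateField.adjoin (ResidueField S.ring) {τ} = ⊤ := by
    rw [eq_top_iff]
    intro z _
    obtain ⟨z, rfl⟩ := residue_surjective z
    obtain ⟨A, hA⟩ := hgen z z.2
    have : residue T.ring z = aeval τ (S.red A) := by
      rw [haeval, ← sub_eq_zero, ← map_sub, residue_eq_zero_iff]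
      exact hA.2
    rw [this]
    exact IntermediateField.algebra_adjoin_le_adjoin _ _ (aeval_mem_adjoin_singleton _ _)
  rw [← IntermediateField.finrank_top', ← htop, IntermediateField.adjoin.finrank hint, ← hmin,
    natDegree_mul_leadingCoeff_inv _ hF.ne_zero]

end Point

/-! ### Noether's formula along a smooth branch -/

/-- The curve `g` has contact order `k` with the curve `e`, where `e, z` are parameters of a
two-dimensional regular local ring: the residue class of `g` has value `k` in the discrete
valuation ring `A / eA`, which has uniformizer `z`. -/
def HasContact {A : Type*} [CommRing A] (e z g : A) (k : ℕ) : Prop :=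
  ∃ u c : A, IsUnit u ∧ g = u * z ^ k + e * c

theorem HasContact.not_dvd {A : Type*} [CommRing A] {e z g : A} {k : ℕ} (h : HasContact e z g k)
    (he : Prime e) (hez : ¬ e ∣ z) : ¬ e ∣ g := by
  obtain ⟨u, c, hu, rfl⟩ := h
  rw [dvd_add_left (Dvd.intro _ rfl), hu.dvd_mul_left]
  exact fun hd => hez (he.dvd_of_dvd_pow hd)

theorem HasContact.le {A : Type*} [CommRing A] [IsLocalRing A] {e z g : A}
    {k l : ℕ} (h : HasContact e z g k) (h' : HasContact e z g l) (he : Prime e) (hez : ¬ e ∣ z)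
    (hz : z ∈ maximalIdeal A) : k ≤ l := by
  obtain ⟨u, c, hu, rfl⟩ := h
  obtain ⟨u', c', hu', heq⟩ := h'
  by_contra! hlt
  have e1 : z ^ k = z ^ (k - l) * z ^ l := by rw [← pow_add, Nat.sub_add_cancel hlt.le]
  rw [e1] at heq
  have hd : e ∣ (u' - u * z ^ (k - l)) * z ^ l := ⟨c - c', by linear_combination -heq⟩
  rcases he.dvd_or_dvd hd with h1 | h1
  · have hmem : u' - u * z ^ (k - l) ∈ maximalIdeal A := by
      intro hunit
      exact he.not_isUnit (isUnit_of_dvd_unit h1 hunit)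
    have h2 : u * z ^ (k - l) ∈ maximalIdeal A :=
      Ideal.mul_mem_left _ _ (Ideal.pow_mem_of_mem _ hz _ (by omega))
    have := Ideal.add_mem _ hmem h2
    rw [sub_add_cancel] at this
    exact this hu'
  · exact hez (he.dvd_of_dvd_pow h1)

theorem idealOrd_top {A : Type*} [CommRing A] [IsLocalRing A] [IsNoetherianRing A] [IsDomain A] :
    idealOrd (⊤ : Ideal A) = 0 := by
  rw [← Ideal.span_singleton_one, idealOrd_span_singleton one_ne_zero,
    elemOrd_eq_zero_of_isUnit isUnit_one]

namespace Point

variable {K : Type*} [Field K] {R S T : Point K}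

theorem ev_eq_coeff_zero_add (A : S.ring[X]) (t : K) :
    S.ev t A = A.coeff 0 + t * S.ev t A.divX := by
  conv_lhs => rw [← divX_mul_X_add A, map_add, map_mul, ev_X, ev_C]
  ring

/-- The points over `T` that are contained in the valuation ring `V`. -/
def overIn (T : Point K) (V : ValuationSubring K) : Set (Point K) :=
  {T' | T ≤ T' ∧ ∀ a ∈ T'.ring, a ∈ V}

/-- The points over `R` through which the curve `fR` passes. -/
def onCurve (R : Point K) (f : R.ring) : Set (Point K) :=
  {T | ∃ h : R ≤ T, strict h (Ideal.span {f}) ≠ ⊤}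

open Classical in
/-- The multiplicity at `T` of the strict transform of `fR`, weighted by the degree of `T` over
`S`. -/
def weight (R S : Point K) (f : R.ring) (T : Point K) : ℕ :=
  if h : R ≤ T ∧ S ≤ T then degree h.2 * idealOrd (strict h.1 (Ideal.span {f})) else 0

theorem weight_eq {f : R.ring} (h : R ≤ T) (h' : S ≤ T) :
    weight R S f T = degree h' * idealOrd (strict h (Ideal.span {f})) :=
  dif_pos ⟨h, h'⟩

theorem support_weight_subset (R S : Point K) (f : R.ring) :
    Function.support (weight R S f) ⊆ onCurve R f := by
  intro T hT
  by_cases h : R ≤ T ∧ S ≤ T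
  · refine ⟨h.1, fun htop => hT ?_⟩
    rw [weight_eq h.1 h.2, htop, idealOrd_top, mul_zero]
  · exact absurd (dif_neg h) hT

theorem not_onCurve_of_isUnit {f : R.ring} {g : S.ring} {h : R ≤ S} (hs : IsStrict h f g)
    (hg : IsUnit g) (h' : S ≤ T) : T ∉ onCurve R f :=
  fun ⟨_, hT⟩ => hT (hs.strict_eq_top hg h')

theorem irreducible_red_X (S : Point K) : Irreducible (S.red X) := by
  rw [red_X]
  exact irreducible_X

theorem red_X_dvd_iff {A : S.ring[X]} :
    S.red X ∣ S.red A ↔ A.coeff 0 ∈ maximalIdeal S.ring := by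
  rw [red_X, X_dvd_iff, coeff_red, residue_eq_zero_iff]

/-- The data of a smooth branch at a point `T`: parameters `e, z` of `T` such that the curve `e` is
the centre on `T` of the valuation ring `V`. -/
structure IsBranch (V : ValuationSubring K) {T : Point K} (e z : T.ring) : Prop where
  params : IsParamPair e z
  le : ∀ a ∈ T.ring, a ∈ V
  dvd_iff : ∀ a : T.ring, e ∣ a ↔ V.valuation (a : K) < 1

namespace IsBranch

variable {V : ValuationSubring K} {e z : T.ring}

theorem val_left (hb : IsBranch V e z) : V.valuation (e : K) < 1 := (hb.dvd_iff e).1 dvd_rfl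

theorem val_right (hb : IsBranch V e z) : V.valuation (z : K) = 1 := by
  refine le_antisymm ((V.valuation_le_one_iff _).2 (hb.le z z.2)) (not_lt.1 fun hlt => ?_)
  exact hb.params.not_dvd ((hb.dvd_iff z).2 hlt)

theorem val_div (hb : IsBranch V e z) : V.valuation ((e : K) / z) < 1 := by
  rw [map_div₀, hb.val_right, div_one]
  exact hb.val_left

theorem ev_mem (hb : IsBranch V e z) (A : T.ring[X]) : T.ev ((e : K) / z) A ∈ V := by
  have : T.ev ((e : K) / z) A = ∑ i ∈ A.support, ((A.coeff i : K) * ((e : K) / z) ^ i) := by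
    change eval₂ _ _ A = _
    rw [eval₂_eq_sum, Polynomial.sum]
    rfl
  rw [this]
  exact V.toSubring.sum_mem fun i _ => V.toSubring.mul_mem (hb.le _ (A.coeff i).2)
    (V.toSubring.pow_mem ((V.valuation_le_one_iff _).1 hb.val_div.le) i)

theorem val_ev_lt_one_iff (hb : IsBranch V e z) (A : T.ring[X]) :
    V.valuation (T.ev ((e : K) / z) A) < 1 ↔ e ∣ A.coeff 0 := by
  have h1 : V.valuation ((e : K) / z * T.ev ((e : K) / z) A.divX) < 1 := by
    rw [map_mul]
    exact mul_lt_one_of_lt_of_le hb.val_div ((V.valuation_le_one_iff _).2 (hb.ev_mem _))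
  rw [hb.dvd_iff, ev_eq_coeff_zero_add]
  constructor
  · intro h
    have := V.valuation.map_sub_lt h h1
    rwa [add_sub_cancel_right] at this
  · exact fun h => V.valuation.map_add_lt h h1

/-- The point on the strict transform of the branch in the blow-up of `T`. -/
def next (hb : IsBranch V e z) : Point K := hb.params.symm.blowup T.irreducible_red_X

theorem le_next (hb : IsBranch V e z) : T ≤ hb.next := hb.params.symm.le_blowup _

/-- The strict transform of the branch. -/
def nextLeft (hb : IsBranch V e z) : hb.next.ring :=
  ⟨_, hb.params.symm.ev_mem_blowup T.irreducible_red_X X⟩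

theorem coe_nextLeft (hb : IsBranch V e z) : (hb.nextLeft : K) = (e : K) / z := T.ev_X _

theorem incl_left (hb : IsBranch V e z) :
    incl hb.le_next e = hb.nextLeft * incl hb.le_next z := by
  apply Subtype.ext
  rw [Subring.coe_mul, coe_nextLeft, coe_incl, coe_incl,
    div_mul_cancel₀ _ hb.params.symm.coe_ne_zero]

theorem isBranch_next (hb : IsBranch V e z) :
    IsBranch V hb.nextLeft (incl hb.le_next z) := by
  have hval : ∀ B : T.ring[X], ¬ T.red X ∣ T.red B →
      V.valuation (T.ev ((e : K) / z) B) = 1 := by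
    intro B hB
    refine le_antisymm ((V.valuation_le_one_iff _).2 (hb.ev_mem B)) (not_lt.1 fun hlt => hB ?_)
    rw [hb.val_ev_lt_one_iff] at hlt
    rw [red_X_dvd_iff]
    exact Ideal.mem_of_dvd _ hlt hb.params.left_mem
  have hle : ∀ a ∈ hb.next.ring, a ∈ V := by
    rintro a ⟨A, B, hB, rfl⟩
    rw [← V.valuation_le_one_iff, map_div₀, hval B hB, div_one, V.valuation_le_one_iff]
    exact hb.ev_mem A
  refine ⟨(hb.params.symm.blowup_params T.irreducible_red_X).symm, hle, fun a => ?_⟩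
  constructor
  · rintro ⟨c, rfl⟩
    rw [Subring.coe_mul, map_mul, coe_nextLeft]
    exact mul_lt_one_of_lt_of_le hb.val_div ((V.valuation_le_one_iff _).2 (hle c c.2))
  · intro ha
    obtain ⟨a, A, B, hB, rfl⟩ := a
    change V.valuation (_ / _) < 1 at ha
    rw [map_div₀, hval B hB, div_one, hb.val_ev_lt_one_iff] at ha
    obtain ⟨c, hc⟩ := ha
    refine ⟨⟨_, C (z * c) + A.divX, B, hB, rfl⟩, Subtype.ext ?_⟩
    have hz0 := hb.params.symm.coe_ne_zero
    rw [Subring.coe_mul, coe_nextLeft]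
    change T.ev ((e : K) / z) A / _ = _ * (_ / _)
    rw [ev_eq_coeff_zero_add A, hc, map_add, ev_C]
    push_cast
    field_simp

theorem next_ne (hb : IsBranch V e z) : hb.next ≠ T := hb.params.symm.blowup_ne _

/-- The points over `T` inside `V` form a chain, starting with `T` and the point of the branch in
the blow-up of `T`. -/
theorem overIn_eq (hb : IsBranch V e z) : overIn T V = insert T (overIn hb.next V) := by
  ext T'
  rw [Set.mem_insert_iff]
  constructor
  · rintro ⟨hle, hV⟩
    by_cases hne : T' = T
    · exact Or.inl hne
    have hnot : (z : K) / e ∉ T'.ring := by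
      intro hm
      have h1 := (V.valuation_le_one_iff _).2 (hV _ hm)
      rw [← inv_div, map_inv₀] at h1
      have h2 : 0 < V.valuation ((e : K) / z) := by
        rw [zero_lt_iff, Valuation.ne_zero_iff]
        exact div_ne_zero hb.params.coe_ne_zero hb.params.symm.coe_ne_zero
      exact absurd hb.val_div (not_lt.2 ((inv_le_one₀ h2).1 h1))
    have hmem := (hb.params.symm.div_mem_or_div_mem hle hne).resolve_right hnot
    refine Or.inr ⟨hb.params.symm.blowup_le _ hle hmem ?_, hV⟩
    rw [ev_X]
    by_contra hmax
    apply hnot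
    rw [← inv_div]
    exact inv_mem_of_notMem_maxSet hmem hmax
  · rintro (rfl | ⟨hle, hV⟩)
    · exact ⟨fun _ h => h, hb.le⟩
    · exact ⟨le_trans' hb.le_next hle, hV⟩

theorem notMem_overIn_next (hb : IsBranch V e z) : T ∉ overIn hb.next V :=
  fun h => hb.next_ne (ext_of_le hb.le_next h.1)

/-- The residue field does not change along a branch. -/
theorem exists_sub_mem_maxSet (hb : IsBranch V e z) {a : K} (ha : a ∈ hb.next.ring) :
    ∃ b ∈ T.ring, a - b ∈ hb.next.maxSet := by
  obtain ⟨A, hA⟩ := hb.params.symm.exists_sub_ev_mem_maxSet T.irreducible_red_X ha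
  refine ⟨A.coeff 0, (A.coeff 0).2, ?_⟩
  have h1 : T.ev ((e : K) / z) A.divX * ((e : K) / z) ∈ hb.next.maxSet := by
    refine mul_mem_maxSet (hb.params.symm.ev_mem_blowup _ _) ?_
    rw [← coe_nextLeft, coe_mem_maxSet]
    exact hb.isBranch_next.params.left_mem
  have e1 : a - A.coeff 0 = (a - T.ev ((e : K) / z) A)
      + T.ev ((e : K) / z) A.divX * ((e : K) / z) := by
    rw [ev_eq_coeff_zero_add A]
    ring
  rw [e1]
  exact add_mem_maxSet hA h1

/-- **Noether's formula** for the intersection multiplicity of a curve with a smooth branch: it is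
the sum of the multiplicities of the curve at the infinitely near points on the branch. -/
theorem sum_weight (hRS : R ≤ S) (f : R.ring) {t : K} {F : S.ring[X]}
    (hF : Irreducible (S.red F)) (k : ℕ) {T : Point K} (hST : S ≤ T) (ht : t ∈ T.ring)
    (hm : S.ev t F ∈ T.maxSet) (hgen : ∀ a ∈ T.ring, ∃ A : S.ring[X], a - S.ev t A ∈ T.maxSet)
    {e z g : T.ring} (hb : IsBranch V e z) (hg : IsStrict (le_trans' hRS hST) f g)
    (hk : HasContact e z g k) :
    (overIn T V ∩ onCurve R f).Finite ∧
      ∑ᶠ T' ∈ overIn T V, weight R S f T' = (S.red F).natDegree * k := by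
  induction k using Nat.strong_induction_on generalizing T with
  | h k ih =>
  rcases Nat.eq_zero_or_pos k with rfl | hkpos
  · obtain ⟨u, c, hu, hgc⟩ := hk
    have hgu : IsUnit g := by
      by_contra hcon
      have h1 : g ∈ maximalIdeal T.ring := hcon
      rw [hgc, pow_zero, mul_one,
        Ideal.add_mem_iff_left _ (Ideal.mul_mem_right _ _ hb.params.left_mem)] at h1
      exact h1 hu
    have hnot : ∀ T' ∈ overIn T V, T' ∉ onCurve R f := fun T' hT' =>
      not_onCurve_of_isUnit hg hgu hT'.1
    refine ⟨?_, ?_⟩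
    · rw [(Set.disjoint_left.2 hnot).inter_eq]
      exact Set.finite_empty
    · rw [mul_zero]
      refine finsum_mem_eq_zero_of_forall_eq_zero fun T' hT' => ?_
      by_contra h0
      exact hnot T' hT' (support_weight_subset R S f h0)
  · obtain ⟨A, hAd, hA, hgA⟩ := hb.params.symm.exists_leading_form hg.1
    have hb' := hb.isBranch_next
    have hg' := isStrict_blowup hb.params.symm T.irreducible_red_X hA hgA
    set n := elemOrd g with hn
    set g' : hb.next.ring := ⟨_, hb.params.symm.ev_mem_blowup T.irreducible_red_X A⟩ with hg'def
    have hgg' : incl hb.le_next g = incl hb.le_next z ^ n * g' := Subtype.ext hgA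
    have hndvd : ¬ hb.nextLeft ∣ g' := by
      intro hd
      rw [hb'.dvd_iff] at hd
      refine hk.not_dvd hb.params.prime hb.params.not_dvd ((hb.dvd_iff g).2 ?_)
      have : (g : K) = (z : K) ^ n * g' := hgA
      rw [this, map_mul, map_pow, hb.val_right, one_pow, one_mul]
      exact hd
    obtain ⟨k', u', c', hu', hk'⟩ := hb'.params.exists_unit_mul_pow hndvd
    have hsum : k = n + k' := by
      have h1 : HasContact hb.nextLeft (incl hb.le_next z) (incl hb.le_next g) k := by
        obtain ⟨u, c, hu, hgc⟩ := hk
        refine ⟨incl hb.le_next u, incl hb.le_next z * incl hb.le_next c, hu.map _, ?_⟩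
        rw [hgc, map_add, map_mul, map_mul, map_pow, hb.incl_left]
        ring
      have h2 : HasContact hb.nextLeft (incl hb.le_next z) (incl hb.le_next g) (n + k') := by
        refine ⟨u', incl hb.le_next z ^ n * c', hu', ?_⟩
        rw [hgg', hk']
        ring
      exact le_antisymm
        (h1.le h2 hb'.params.prime hb'.params.not_dvd hb'.params.right_mem)
        (h2.le h1 hb'.params.prime hb'.params.not_dvd hb'.params.right_mem)
    have hnpos : 1 ≤ n := by
      rw [hn, le_elemOrd hg.1, pow_one]
      obtain ⟨u, c, hu, hgc⟩ := hk
      rw [hgc]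
      exact Ideal.add_mem _ (Ideal.mul_mem_left _ _
        (Ideal.pow_mem_of_mem _ hb.params.right_mem _ hkpos))
        (Ideal.mul_mem_right _ _ hb.params.left_mem)
    obtain ⟨hfin, hsum'⟩ := ih k' (by omega) (le_trans' hST hb.le_next) (hb.le_next ht)
      (maxSet_subset hb.le_next hm) (fun a ha => by
        obtain ⟨b, hbT, hab⟩ := hb.exists_sub_mem_maxSet ha
        obtain ⟨B, hB⟩ := hgen b hbT
        refine ⟨B, ?_⟩
        rw [← sub_add_sub_cancel a b]
        exact add_mem_maxSet hab (maxSet_subset hb.le_next hB)) hb' (hg.trans hg')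
      ⟨u', c', hu', hk'⟩
    rw [hb.overIn_eq]
    refine ⟨?_, ?_⟩
    · refine (hfin.insert T).subset ?_
      rintro T' ⟨rfl | h1, h2⟩
      · exact Set.mem_insert _ _
      · exact Set.mem_insert_of_mem _ ⟨h1, h2⟩
    · rw [finsum_mem_insert' _ hb.notMem_overIn_next (hfin.subset
        (Set.inter_subset_inter_right _ (support_weight_subset R S f))), hsum',
        weight_eq (le_trans' hRS hST) hST, hg.idealOrd_eq,
        degree_eq_natDegree hST ht hF hm hgen, hsum]
      ring

end IsBranch

end Point

/-! ### Summation over the exceptional line -/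

/-- The number of zeros of a form of degree `n` at infinity is the difference between `n` and the
degree of its dehomogenization. -/
theorem exists_reflect_eq {k : Type*} [Field k] {P : k[X]} (hP : P ≠ 0) {n : ℕ}
    (hn : P.natDegree ≤ n) : ∃ G, P.reflect n = X ^ (n - P.natDegree) * G ∧ ¬ X ∣ G := by
  have hdvd : X ^ (n - P.natDegree) ∣ P.reflect n := by
    rw [X_pow_dvd_iff]
    intro d hd
    rw [coeff_reflect, revAt_le (by omega)]
    exact coeff_eq_zero_of_natDegree_lt (by omega)
  obtain ⟨G, hG⟩ := hdvd
  refine ⟨G, hG, fun hX => ?_⟩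
  have h1 := congrArg (fun Q => coeff Q (n - P.natDegree)) hG
  simp only [coeff_reflect] at h1
  rw [revAt_le (by omega), Nat.sub_sub_self hn, coeff_X_pow_mul', if_pos le_rfl, Nat.sub_self,
    X_dvd_iff.1 hX] at h1
  exact hP (leadingCoeff_eq_zero.1 h1)

open Classical in
/-- A polynomial has as many zeros as its degree, closed points being counted with multiplicity and
degree. -/
theorem sum_natDegree_mul_count {k : Type*} [Field k] {P : k[X]} (hP : P ≠ 0) :
    ∑ p ∈ (UniqueFactorizationMonoid.normalizedFactors P).toFinset,
      p.natDegree * (UniqueFactorizationMonoid.normalizedFactors P).count p = P.natDegree := by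
  have h1 := natDegree_eq_of_degree_eq (degree_eq_degree_of_associated
    (UniqueFactorizationMonoid.prod_normalizedFactors hP))
  rw [natDegree_multiset_prod _ (UniqueFactorizationMonoid.zero_notMem_normalizedFactors P),
    Finset.sum_multiset_map_count] at h1
  rw [← h1]
  exact Finset.sum_congr rfl fun p _ => by rw [smul_eq_mul, mul_comm]

open Classical in
theorem exists_eq_pow_count_mul {k : Type*} [Field k] {P p : k[X]} (hP : P ≠ 0)
    (hp : p ∈ UniqueFactorizationMonoid.normalizedFactors P) :
    ∃ G, P = p ^ (UniqueFactorizationMonoid.normalizedFactors P).count p * G ∧ ¬ p ∣ G := by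
  have h1 := UniqueFactorizationMonoid.emultiplicity_eq_count_normalizedFactors
    (UniqueFactorizationMonoid.irreducible_of_normalized_factor p hp) hP
  rw [UniqueFactorizationMonoid.normalize_normalized_factor p hp, emultiplicity_eq_coe] at h1
  obtain ⟨⟨G, hG⟩, h2⟩ := h1
  refine ⟨G, hG, fun ⟨Q, hQ⟩ => h2 ⟨Q, ?_⟩⟩
  conv_lhs => rw [hG, hQ]
  ring

namespace IsParamPair

open Point

variable {K : Type*} [Field K] {R S T : Point K} {x y : S.ring}

theorem ev_mem_maxSet_of_red_dvd (hp : IsParamPair x y) (h : S ≤ T) (ht : (y : K) / x ∈ T.ring)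
    {F G : S.ring[X]} (hFG : S.red F ∣ S.red G) (hF : S.ev ((y : K) / x) F ∈ T.maxSet) :
    S.ev ((y : K) / x) G ∈ T.maxSet := by
  obtain ⟨Q, hQ⟩ := hFG
  obtain ⟨Q, rfl⟩ := S.red_surjective Q
  rw [← map_mul, ← sub_eq_zero, ← map_sub] at hQ
  obtain ⟨D, hD⟩ := hp.exists_ev_eq_mul hQ
  have e : S.ev ((y : K) / x) G = S.ev ((y : K) / x) Q * S.ev ((y : K) / x) F
      + S.ev ((y : K) / x) D * x := by
    simp only [map_sub, map_mul] at hD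
    linear_combination hD
  rw [e]
  exact add_mem_maxSet (mul_mem_maxSet (ev_mem h ht Q) hF)
    (mul_mem_maxSet (ev_mem h ht D) ((coe_mem_maxSet_iff h).2 hp.left_mem))

/-- Every point of the affine chart with coordinate `y / x` lies over a closed point of
the affine line; otherwise it would contain the order valuation ring. -/
theorem exists_irreducible_ev_mem (hp : IsParamPair x y) (h : S ≤ T)
    (ht : (y : K) / x ∈ T.ring) :
    ∃ F : S.ring[X], Irreducible (S.red F) ∧ S.ev ((y : K) / x) F ∈ T.maxSet := by
  obtain ⟨G, hG0, hG⟩ : ∃ G : S.ring[X], S.red G ≠ 0 ∧ S.ev ((y : K) / x) G ∈ T.maxSet := by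
    by_contra! hcon
    obtain ⟨z, hz, hz'⟩ := T.exists_notMem_inv_notMem
    have hVT : ∀ a ∈ S.orderVal, a ∈ T.ring := by
      intro a ha
      obtain ⟨A, B, hB, rfl⟩ := hp.mem_orderVal_iff.1 ha
      rw [div_eq_mul_inv]
      exact T.ring.mul_mem (ev_mem h ht A) (inv_mem_of_notMem_maxSet (ev_mem h ht B) (hcon B hB))
    exact (S.orderVal.mem_or_inv_mem z).elim (fun hm => hz (hVT _ hm)) fun hm => hz' (hVT _ hm)
  generalize hP : S.red G = P at hG0
  induction P using WfDvdMonoid.induction_on_irreducible generalizing G with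
  | zero => exact absurd rfl hG0
  | unit u hu =>
    exfalso
    have h1 : S.ev ((y : K) / x) 1 ∈ T.maxSet :=
      hp.ev_mem_maxSet_of_red_dvd h ht (hP ▸ hu.dvd) hG
    rw [map_one] at h1
    exact one_notMem_maxSet h1
  | mul a i ha hi ih =>
    obtain ⟨A, rfl⟩ := S.red_surjective a
    obtain ⟨I, rfl⟩ := S.red_surjective i
    have h1 : S.ev ((y : K) / x) (I * A) ∈ T.maxSet :=
      hp.ev_mem_maxSet_of_red_dvd h ht (by rw [hP, map_mul]) hG
    rw [map_mul] at h1
    rcases mem_or_mem_maxSet (ev_mem h ht I) (ev_mem h ht A) h1 with h2 | h2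
    · exact ⟨I, hi, h2⟩
    · exact ih A h2 rfl ha

theorem isBranch_blowup (hp : IsParamPair x y) {F : S.ring[X]} (hF : Irreducible (S.red F)) :
    IsBranch S.orderVal (incl (hp.le_blowup hF) x)
      (⟨_, hp.ev_mem_blowup hF F⟩ : (hp.blowup hF).ring) :=
  ⟨hp.blowup_params hF, fun _ ha => hp.blowup_le_orderVal hF ha, fun _ => hp.incl_dvd_iff hF⟩

/-- Noether's formula on the exceptional line: the points over the closed point `F = 0` contribute
the multiplicity of the zero of the leading form at this point. -/
theorem sum_weight_blowup (hp : IsParamPair x y) {F : S.ring[X]} (hF : Irreducible (S.red F))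
    (hRS : R ≤ S) {f : R.ring} {g : S.ring} (hg : IsStrict hRS f g) {n : ℕ} {A : S.ring[X]}
    (hA : S.red A ≠ 0) (hgA : (g : K) = (x : K) ^ n * S.ev ((y : K) / x) A) {k : ℕ}
    {G : (ResidueField S.ring)[X]} (hAG : S.red A = S.red F ^ k * G) (hG : ¬ S.red F ∣ G) :
    (overIn (hp.blowup hF) S.orderVal ∩ onCurve R f).Finite ∧
      ∑ᶠ T ∈ overIn (hp.blowup hF) S.orderVal, weight R S f T = (S.red F).natDegree * k := by
  obtain ⟨G, rfl⟩ := S.red_surjective G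
  have ht : (y : K) / x ∈ (hp.blowup hF).ring := by
    rw [← S.ev_X ((y : K) / x)]
    exact hp.ev_mem_blowup hF X
  refine (hp.isBranch_blowup hF).sum_weight hRS f hF k (hp.le_blowup hF) ht
    ((hp.ev_mem_maxSet_blowup_iff hF).2 dvd_rfl)
    (fun a ha => hp.exists_sub_ev_mem_maxSet hF ha) (hg.trans (isStrict_blowup hp hF hA hgA)) ?_
  rw [← map_pow, ← map_mul, ← sub_eq_zero, ← map_sub] at hAG
  obtain ⟨D, hD⟩ := hp.exists_ev_eq_mul hAG
  refine ⟨⟨_, hp.ev_mem_blowup hF G⟩, ⟨_, hp.ev_mem_blowup hF D⟩, ?_, Subtype.ext ?_⟩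
  · rw [isUnit_iff_notMem_maxSet]
    change S.ev ((y : K) / x) G ∉ _
    rwa [hp.ev_mem_maxSet_blowup_iff hF]
  · change S.ev _ A = S.ev _ G * S.ev _ F ^ k + x * S.ev _ D
    rw [← hD]
    simp only [map_sub, map_mul, map_pow]
    ring

/-- The points over `S`, inside the order valuation ring, that lie over the closed point `p = 0`
of the affine chart with coordinate `y / x` of the exceptional line. -/
def chart (_ : IsParamPair x y) (p : (ResidueField S.ring)[X]) : Set (Point K) :=
  {T | T ∈ overIn S S.orderVal ∧ (y : K) / x ∈ T.ring ∧
    ∃ F : S.ring[X], S.red F = p ∧ S.ev ((y : K) / x) F ∈ T.maxSet}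

theorem chart_eq_overIn (hp : IsParamPair x y) {F : S.ring[X]} (hF : Irreducible (S.red F)) :
    hp.chart (S.red F) = overIn (hp.blowup hF) S.orderVal := by
  ext T
  constructor
  · rintro ⟨⟨h, hV⟩, ht, G, hGF, hG⟩
    exact ⟨hp.blowup_le hF h ht (hp.ev_mem_maxSet_of_red_dvd h ht hGF.dvd hG), hV⟩
  · rintro ⟨h, hV⟩
    refine ⟨⟨le_trans' (hp.le_blowup hF) h, hV⟩, ?_, F, rfl, ?_⟩
    · rw [← S.ev_X ((y : K) / x)]
      exact h (hp.ev_mem_blowup hF X)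
    · exact maxSet_subset h ((hp.ev_mem_maxSet_blowup_iff hF).2 dvd_rfl)

theorem chart_disjoint (hp : IsParamPair x y) {p q : (ResidueField S.ring)[X]}
    (hp' : Irreducible p) (hpq : ¬ p ∣ q) : Disjoint (hp.chart p) (hp.chart q) := by
  rw [Set.disjoint_left]
  obtain ⟨F, rfl⟩ := S.red_surjective p
  rw [hp.chart_eq_overIn hp']
  rintro T ⟨h, -⟩ ⟨-, -, G, rfl, hG⟩
  refine hpq ((hp.ev_mem_maxSet_blowup_iff hp').1 ?_)
  exact (coe_mem_maxSet_iff h (a := ⟨_, hp.ev_mem_blowup hp' G⟩)).1 hG |> coe_mem_maxSet.2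

/-- The points over `S` inside the order valuation ring, other than `S`, lie over closed points of
the exceptional line. -/
theorem exists_mem_chart (hp : IsParamPair x y) (h : T ∈ overIn S S.orderVal) (hne : T ≠ S) :
    (∃ p, Irreducible p ∧ T ∈ hp.chart p) ∨ T ∈ hp.symm.chart X := by
  by_cases ht : (y : K) / x ∈ T.ring
  · obtain ⟨F, hF, hFm⟩ := hp.exists_irreducible_ev_mem h.1 ht
    exact Or.inl ⟨S.red F, hF, h, ht, F, rfl, hFm⟩
  · have ht' := (hp.div_mem_or_div_mem h.1 hne).resolve_left ht
    refine Or.inr ⟨h, ht', X, S.red_X, ?_⟩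
    rw [ev_X]
    by_contra hm
    apply ht
    rw [← inv_div]
    exact inv_mem_of_notMem_maxSet ht' hm

theorem ne_of_mem_chart (hp : IsParamPair x y) {p : (ResidueField S.ring)[X]}
    (h : T ∈ hp.chart p) : T ≠ S := by
  rintro rfl
  exact hp.not_dvd ⟨⟨_, h.2.1⟩, Subtype.ext (mul_div_cancel₀ _ hp.coe_ne_zero).symm⟩

theorem dvd_of_mem_onCurve (hp : IsParamPair x y) (hRS : R ≤ S) {f : R.ring} {g : S.ring}
    (hg : IsStrict hRS f g) {n : ℕ} {A : S.ring[X]} (hA : S.red A ≠ 0)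
    (hgA : (g : K) = (x : K) ^ n * S.ev ((y : K) / x) A) {p : (ResidueField S.ring)[X]}
    (hp' : Irreducible p) (hT : T ∈ hp.chart p) (hTf : T ∈ onCurve R f) : p ∣ S.red A := by
  obtain ⟨F, rfl⟩ := S.red_surjective p
  rw [hp.chart_eq_overIn hp'] at hT
  by_contra hcon
  refine not_onCurve_of_isUnit (hg.trans (isStrict_blowup hp hp' hA hgA)) ?_ hT.1 hTf
  rw [isUnit_iff_notMem_maxSet]
  change S.ev _ A ∉ _
  rwa [hp.ev_mem_maxSet_blowup_iff hp']

theorem ev_reflect (hp : IsParamPair x y) {n : ℕ} {A : S.ring[X]} (hA : A.natDegree ≤ n) :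
    (y : K) ^ n * S.ev ((x : K) / y) (A.reflect n) = (x : K) ^ n * S.ev ((y : K) / x) A := by
  have hx := hp.coe_ne_zero
  have hy := hp.symm.coe_ne_zero
  have ht : (y : K) / x ≠ 0 := div_ne_zero hy hx
  let _ : Invertible ((y : K) / x) := invertibleOfNonzero ht
  have h1 := eval₂_reflect_mul_pow S.ring.subtype ((y : K) / x) n A hA
  rw [invOf_eq_inv, inv_div] at h1
  change _ = _ * eval₂ _ _ A
  rw [← h1, div_pow]
  change _ * eval₂ _ _ _ = _
  field_simp

end IsParamPair

namespace Point

variable {K : Type*} [Field K] {R S : Point K}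

open Classical in
/-- The degree of the leading form is the number of its zeros on the exceptional line, each of which
is counted by Noether's formula. -/
theorem sum_weight_proximate (hRS : R ≤ S) {f : R.ring} (hf : f ≠ 0) :
    ({T | IsProximate S T ∧ T ≠ S} ∩ onCurve R f).Finite ∧
      ∑ᶠ T ∈ {T | IsProximate S T ∧ T ≠ S}, weight R S f T =
        idealOrd (strict hRS (Ideal.span {f})) := by
  obtain ⟨g, hg⟩ := exists_isStrict hRS hf
  obtain ⟨x, y, hp⟩ := S.exists_params
  obtain ⟨A, hAn, hA, hgA⟩ := hp.exists_leading_form hg.1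
  rw [hg.idealOrd_eq]
  set n := elemOrd g
  set V := S.orderVal
  let P := S.red A
  have hPn : P.natDegree ≤ n := natDegree_map_le.trans hAn
  let I := (UniqueFactorizationMonoid.normalizedFactors P).toFinset
  have hI : ∀ p ∈ I, p ∈ UniqueFactorizationMonoid.normalizedFactors P := fun p h =>
    Multiset.mem_toFinset.1 h
  have hIirr : ∀ p ∈ I, Irreducible p := fun p h =>
    UniqueFactorizationMonoid.irreducible_of_normalized_factor p (hI p h)
  -- the finite points of the exceptional line
  have hfin : ∀ p ∈ I, (hp.chart p ∩ onCurve R f).Finite ∧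
      ∑ᶠ T ∈ hp.chart p, weight R S f T
        = p.natDegree * (UniqueFactorizationMonoid.normalizedFactors P).count p := by
    intro p hpI
    obtain ⟨G, hPG, hG⟩ := exists_eq_pow_count_mul hA (hI p hpI)
    have hirr := hIirr p hpI
    obtain ⟨F, hFp⟩ := S.red_surjective p
    rw [← hFp] at hirr hG hPG ⊢
    rw [hp.chart_eq_overIn hirr]
    exact hp.sum_weight_blowup hirr hRS hg hA hgA hPG hG
  -- the point at infinity
  have hA' : S.red (A.reflect n) = P.reflect n := (reflect_map _ _ _).symm
  obtain ⟨G, hPG, hG⟩ := exists_reflect_eq hA hPn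
  have hA0' : S.red (A.reflect n) ≠ 0 := by
    rw [hA', Ne, reflect_eq_zero_iff]
    exact hA
  have hgA' : (g : K) = (y : K) ^ n * S.ev ((x : K) / y) (A.reflect n) := by
    rw [hp.ev_reflect hAn, hgA]
  have hinf : (hp.symm.chart X ∩ onCurve R f).Finite ∧
      ∑ᶠ T ∈ hp.symm.chart X, weight R S f T = n - P.natDegree := by
    have h1 := hp.symm.sum_weight_blowup S.irreducible_red_X hRS hg hA0' hgA'
      (by rw [hA', red_X]; exact hPG) (by rw [red_X]; exact hG)
    rw [← hp.symm.chart_eq_overIn, red_X, natDegree_X, one_mul] at h1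
    exact h1
  have hdisj : (I : Set (ResidueField S.ring)[X]).PairwiseDisjoint
      fun p => hp.chart p ∩ onCurve R f := by
    intro p hpI q hqI hpq
    refine (hp.chart_disjoint (hIirr p hpI) fun hd => hpq ?_).mono Set.inter_subset_left
      Set.inter_subset_left
    have hass := (hIirr p hpI).associated_of_dvd (hIirr q hqI) hd
    rw [← UniqueFactorizationMonoid.normalize_normalized_factor p (hI p hpI),
      ← UniqueFactorizationMonoid.normalize_normalized_factor q (hI q hqI)]
    exact normalize_eq_normalize_iff_associated.2 hass
  have hdisj' : Disjoint (⋃ p ∈ (I : Set (ResidueField S.ring)[X]), hp.chart p ∩ onCurve R f)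
      (hp.symm.chart X ∩ onCurve R f) := by
    rw [Set.disjoint_left]
    rintro T hT ⟨⟨-, ht', F, hF, hm⟩, -⟩
    obtain ⟨p, -, ⟨⟨hle, -⟩, ht, -⟩, -⟩ := Set.mem_iUnion₂.1 hT
    have hm' := hp.symm.ev_mem_maxSet_of_red_dvd hle ht' (F := F) (G := X)
      (by rw [hF, red_X]) hm
    rw [ev_X, ← inv_div] at hm'
    have ht0 : (y : K) / x ≠ 0 := div_ne_zero hp.symm.coe_ne_zero hp.coe_ne_zero
    exact notMem_maxSet_of_inv_mem (inv_ne_zero ht0) (by rwa [inv_inv]) hm'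
  have hset : {T | IsProximate S T ∧ T ≠ S} ∩ onCurve R f =
      (⋃ p ∈ (I : Set (ResidueField S.ring)[X]), hp.chart p ∩ onCurve R f) ∪
        (hp.symm.chart X ∩ onCurve R f) := by
    ext T
    constructor
    · rintro ⟨⟨hT, hne⟩, hTf⟩
      rcases hp.exists_mem_chart hT hne with ⟨p, hirr, hTp⟩ | hTX
      · have hd := hp.dvd_of_mem_onCurve hRS hg hA hgA hirr hTp hTf
        obtain ⟨q, hq, hpq⟩ :=
          UniqueFactorizationMonoid.exists_mem_normalizedFactors_of_dvd hA hirr hd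
        obtain ⟨F, hF⟩ := S.red_surjective q
        obtain ⟨hb, ht, G, hG, hGm⟩ := hTp
        refine Or.inl (Set.mem_iUnion₂.2 ⟨q, Multiset.mem_toFinset.2 hq, ⟨hb, ht, F, hF, ?_⟩, hTf⟩)
        exact hp.ev_mem_maxSet_of_red_dvd hb.1 ht (by rw [hG, hF]; exact hpq.dvd) hGm
      · exact Or.inr ⟨hTX, hTf⟩
    · rintro (hT | ⟨hT, hTf⟩)
      · obtain ⟨p, -, hTp, hTf⟩ := Set.mem_iUnion₂.1 hT
        exact ⟨⟨hTp.1, hp.ne_of_mem_chart hTp⟩, hTf⟩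
      · exact ⟨⟨hT.1, hp.symm.ne_of_mem_chart hT⟩, hTf⟩
  have hinter : ∀ s : Set (Point K),
      ∑ᶠ T ∈ s, weight R S f T = ∑ᶠ T ∈ s ∩ onCurve R f, weight R S f T := by
    intro s
    refine finsum_mem_inter_support_eq' _ _ _ fun T hT => ?_
    rw [Set.mem_inter_iff, and_iff_left (support_weight_subset R S f hT)]
  have hfinU : (⋃ p ∈ (I : Set (ResidueField S.ring)[X]), hp.chart p ∩ onCurve R f).Finite :=
    I.finite_toSet.biUnion fun p hpI => (hfin p hpI).1
  refine ⟨?_, ?_⟩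
  · rw [hset]
    exact hfinU.union hinf.1
  · rw [hinter, hset, finsum_mem_union hdisj' hfinU hinf.1, ← hinter, hinf.2,
      finsum_mem_biUnion hdisj I.finite_toSet fun p hpI => (hfin p hpI).1,
      finsum_mem_coe_finset]
    have : ∀ p ∈ I, ∑ᶠ T ∈ hp.chart p ∩ onCurve R f, weight R S f T
        = p.natDegree * (UniqueFactorizationMonoid.normalizedFactors P).count p := by
      intro p hpI
      rw [← hinter, (hfin p hpI).2]
    rw [Finset.sum_congr rfl this, sum_natDegree_mul_count hA]
    exact Nat.add_sub_of_le hPn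

/-- The proximity formula for the curve `fR`. -/
theorem proximity_formula (hRS : R ≤ S) {f : R.ring} (hf : f ≠ 0) :
    {T : ProximateTo S | strict (le_trans' hRS T.le) (Ideal.span {f}) ≠ ⊤}.Finite ∧
      idealOrd (strict hRS (Ideal.span {f})) =
        ∑ᶠ T : ProximateTo S, degree T.le *
          idealOrd (strict (le_trans' hRS T.le) (Ideal.span {f})) := by
  obtain ⟨hfin, hsum⟩ := sum_weight_proximate hRS hf
  refine ⟨(hfin.preimage Subtype.val_injective.injOn).subset fun T hT =>
    ⟨T.2, le_trans' hRS (ProximateTo.le T), hT⟩, ?_⟩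
  rw [← hsum, ← finsum_set_coe_eq_finsum_mem]
  exact finsum_congr fun T => weight_eq (le_trans' hRS T.2.1.1) T.2.1.1

/-! ### Curvettes -/

/-- In every point properly containing `R` the maximal ideal of `R` generates a principal ideal with
exceptional prime factors. -/
theorem strict_maximalIdeal_eq_top {T : Point K} (h : R ≤ T) (hne : T ≠ R) :
    strict h (maximalIdeal R.ring) = ⊤ := by
  have key : ∀ x y : R.ring, IsParamPair x y → (y : K) / x ∈ T.ring →
      strict h (maximalIdeal R.ring) = ⊤ := by
    intro x y hp ht
    have hy : incl h y = incl h x * ⟨_, ht⟩ :=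
      Subtype.ext (mul_div_cancel₀ _ hp.coe_ne_zero).symm
    refine top_le_iff.1 (le_sSup ⟨incl h x, incl_ne_zero h hp.left_ne_zero, fun q hq hd => ?_, ?_⟩)
    · rw [isExceptionalPrime_iff h hq]
      intro a ha
      obtain ⟨b, c, rfl⟩ := hp.mem_max_iff.1 ha
      rw [map_add, map_mul, map_mul, hy]
      exact dvd_add (hd.mul_left _) ((hd.mul_right _).mul_left _)
    · rw [Ideal.mul_top, hp.max_eq, Ideal.map_span, Set.image_pair, hy]
      refine le_antisymm ?_ (Ideal.span_mono (by simp))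
      rw [Ideal.span_le]
      rintro z (rfl | rfl)
      · exact Ideal.mem_span_singleton_self _
      · exact Ideal.mul_mem_right _ _ (Ideal.mem_span_singleton_self _)
  obtain ⟨x, y, hp⟩ := R.exists_params
  rcases hp.div_mem_or_div_mem h hne with ht | ht
  exacts [key x y hp ht, key y x hp.symm ht]

/-- A curvette is not exceptional, so it lies over a curve of the base point. -/
theorem IsCurvette.exists_comap_eq_span {T : Point K} {h : R ≤ T} {g : T.ring}
    (hg : IsCurvette h g) : ∃ f ≠ 0, (Ideal.span {g}).comap (incl h) = Ideal.span {f} := by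
  obtain ⟨w, hw, -⟩ := hg.normal_crossing
  have hpw : IsParamPair w g := ⟨hw, T.dim_eq_two⟩
  have hgp : (Ideal.span {g}).IsPrime :=
    (Ideal.span_singleton_prime hpw.ne_zero_right).2 hpw.symm.prime
  have hP : ((Ideal.span {g}).comap (incl h)).IsPrime := Ideal.comap_isPrime _ _
  have hne : (Ideal.span {g}).comap (incl h) ≠ maximalIdeal R.ring := by
    intro hm
    by_cases hTR : T = R
    · subst hTR
      refine hpw.symm.not_dvd ?_
      rw [← Ideal.mem_span_singleton]
      exact hm.ge hpw.left_mem
    · have hs := hg.smooth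
      rw [hm, strict_maximalIdeal_eq_top h hTR, idealOrd_top] at hs
      exact zero_ne_one hs
  obtain ⟨x, y, hp⟩ := R.exists_params
  obtain ⟨f, hf⟩ := hp.exists_eq_span hP hne
  refine ⟨f, ?_, hf⟩
  rintro rfl
  obtain ⟨a, b, hb, hab⟩ := R.exists_div (g : K)
  have hga : incl h a = g * incl h b := by
    apply Subtype.ext
    rw [Subring.coe_mul, hab, coe_incl, coe_incl, div_mul_cancel₀ _ (coe_ne_zero.2 hb)]
  have ha : a ∈ (Ideal.span {g}).comap (incl h) := by
    rw [Ideal.mem_comap, Ideal.mem_span_singleton, hga]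
    exact Dvd.intro _ rfl
  rw [hf, Ideal.mem_span_singleton, zero_dvd_iff] at ha
  rw [ha, map_zero, eq_comm, mul_eq_zero] at hga
  exact hga.elim hpw.ne_zero_right (incl_ne_zero h hb)

end Point

end

theorem proposition5 {K : Type*} [Field K] (R : Point K) :
    (∀ f : R.ring, f ≠ 0 → ∀ (S : Point K) (hS : R ≤ S),
      {T : Point.ProximateTo S |
        Point.strict (Point.le_trans' hS T.le) (Ideal.span {f}) ≠ ⊤}.Finite ∧
      idealOrd (Point.strict hS (Ideal.span {f})) =
        ∑ᶠ T : Point.ProximateTo S, Point.degree T.le *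
          idealOrd (Point.strict (Point.le_trans' hS T.le) (Ideal.span {f}))) ∧
    (∀ (T : Point K) (hT : R ≤ T) (g : T.ring), Point.IsCurvette hT g →
      ∀ (S : Point K) (hS : R ≤ S),
      {T' : Point.ProximateTo S |
        Point.strict (Point.le_trans' hS T'.le)
          ((Ideal.span {g}).comap (Point.incl hT)) ≠ ⊤}.Finite ∧
      idealOrd (Point.strict hS ((Ideal.span {g}).comap (Point.incl hT))) =
        ∑ᶠ T' : Point.ProximateTo S, Point.degree T'.le *
          idealOrd (Point.strict (Point.le_trans' hS T'.le)
            ((Ideal.span {g}).comap (Point.incl hT)))) := by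
  refine ⟨fun f hf S hS => Point.proximity_formula hS hf, fun T hT g hg S hS => ?_⟩
  obtain ⟨f, hf, hgf⟩ := hg.exists_comap_eq_span
  rw [hgf]
  exact Point.proximity_formula hS hf
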